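/- Let $2<p<3$ and put $$B_p=\sqrt2\,\Bigl(\frac{\Gamma(\frac{p+1}{2})}{\sqrt\pi}\Bigr)^{1/p}.$$ (a) Let $\varepsilon_1,\varepsilon_2,\dots$ be independent random variables on a probability space with $\mathbb P(\varepsilon_k=1)=\mathbb P(\varepsilon_k=-1)=\tfrac12$ for every $k$. Then $B_p$ is the optimal constant in the upper Khintchine inequality, that is, $B=B_p$ is the smallest constant $B>0$ such that $$\Bigl(\mathbb E\Bigl|\sum_{k=1}^n a_k\varepsilon_k\Bigr|^p\Bigr)^{1/p}\le B\,\Bigl(\sum_{k=1}^n a_k^2\Bigr)^{1/2}\qquad\text{for all } n\in\mathbb N \text{ and all } (a_1,\dots,a_n)\in\mathbb R^n .$$ (b) For every real $s\ge\sqrt2$ the function $t\mapsto (e^{-st^2/2}-|\cos t|^s)\,t^{-p-1}$ is integrable on $(0,\infty)$ and $$\int_0^\infty\bigl(e^{-st^2/2}-|\cos t|^s\bigr)\,t^{-p-1}\,dt\ge 0 .$$ -/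

import Mathlib

open MeasureTheory ProbabilityTheory

/-- `ε 0, ε 1, ε 2, …` are independent random variables on the probability space `(Ω, P)`,
each taking the values `1` and `-1` with probability `1/2`. -/
structure IsRademacherSequence {Ω : Type*} [MeasurableSpace Ω] (P : Measure Ω)
    (ε : ℕ → Ω → ℝ) : Prop where
  measurable : ∀ k, Measurable (ε k)
  indep : iIndepFun ε P
  prob_one : ∀ k, P {ω | ε k ω = 1} = 1 / 2
  prob_neg_one : ∀ k, P {ω | ε k ω = -1} = 1 / 2

/-- `B > 0` is an upper Khintchine constant for the exponent `p` : for every `n` and every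
`a ∈ ℝⁿ`, the `p`-norm of `∑ a_k ε_k` is at most `B` times the Euclidean norm of `a`. -/
def IsUpperKhintchineConstant {Ω : Type*} [MeasurableSpace Ω] (P : Measure Ω)
    (ε : ℕ → Ω → ℝ) (p B : ℝ) : Prop :=
  0 < B ∧ ∀ (n : ℕ) (a : EuclideanSpace ℝ (Fin n)),
    (∫ ω, |∑ k : Fin n, a k * ε k ω| ^ p ∂P) ^ (1 / p) ≤ B * ‖a‖

/-! ### Polynomial bounds for `cos` and for V = -2 log cos on (0, π/2). -/

section Trigonometric
open Real Set

/-! For 2 < p < 4, |x|^p is a positive multiple of ∫₀^∞ (cos(tx) - 1 + t²x²/2) t^(-p-1) dt, so p-th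
moments of variables with equal variance are compared through their characteristic functions
(`lintegral_abs_rpow_eq`). For S = ∑ b_k ε_k with ∑ b_k² = 1 the characteristic function is ∏
cos(b_k t). By AM-GM with weights b_k² it is at most ∑ b_k² |cos(b_k t)|^(1/b_k²), and rescaling
reduces E|S|^p ≤ E|G|^p, G standard Gaussian, to (b) with s = 1/b_k². This needs every b_k⁴ ≤ 1/2.
If some b_j⁴ > 1/2, then E S⁴ ≤ 2, and interpolation between second and fourth moments gives E|S|^p
≤ 2^((p-2)/2), which is below E|G|^p since Γ ≥ Γ(3/2) on [3/2, ∞). Equal coefficients and Fatou's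
lemma show that the constant cannot be improved.

For (b), the Gaussian dominates |cos| up to a single crossing c in [π/2, π] and is dominated from c
to π. Comparing t^(2-p) with c^(2-p) reduces the claim to the weight t⁻³, at the cost of the
Gaussian tail beyond π (`integral_gaussCosDiff_mul_rpow_nonneg`). For that weight, cos^s =
exp(-sV/2) on (0, π/2). Substituting r = √V in the Gaussian tail and integrating by parts turns the
gain into ½ ∫₀¹ s c^(s-1) (1/x² - 1/V) dc with c = cos x, and a polynomial lower bound for 1/x² -
1/V makes it explicit (`excessBound_one_le`). The loss is ∫ |cos t|^s t⁻³ over (π/2, ∞), estimated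
numerically at s = 1 and s = 2 (`cosTail_add_gaussTail_le`). -/

theorem le_of_hasDerivAt_nonneg {f f' : ℝ → ℝ} {a x : ℝ} (hax : a ≤ x)
    (hf : ∀ y ∈ Icc a x, HasDerivAt f (f' y) y) (hf' : ∀ y ∈ Icc a x, 0 ≤ f' y) :
    f a ≤ f x := by
  have hmono : MonotoneOn f (Icc a x) := by
    refine monotoneOn_of_hasDerivWithinAt_nonneg (f' := f') (convex_Icc a x)
      (fun y hy => (hf y hy).continuousAt.continuousWithinAt) (fun y hy => ?_) (fun y hy => ?_)
    · exact (hf y (interior_subset hy)).hasDerivWithinAt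
    · exact hf' y (interior_subset hy)
  exact hmono (left_mem_Icc.2 hax) (right_mem_Icc.2 hax) hax

/-- This and the following Taylor bounds come from one another by integration from 0: the derivative
of each remainder is the preceding remainder. -/
theorem cos_le_taylor_four {x : ℝ} (hx : 0 ≤ x) : cos x ≤ 1 - x ^ 2 / 2 + x ^ 4 / 24 := by
  have h := le_of_hasDerivAt_nonneg (f := fun x : ℝ => 1 - x ^ 2 / 2 + x ^ 4 / 24 - cos x)
    (f' := fun x => sin x - (x - x ^ 3 / 6)) hx
    (fun y _ => by
      refine HasDerivAt.congr_deriv (((((hasDerivAt_pow 2 y).div_const 2).const_sub 1).add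
        ((hasDerivAt_pow 4 y).div_const 24)).sub (hasDerivAt_cos y)) ?_
      push_cast; ring)
    (fun y hy => sub_nonneg.2 (sin_ge_sub_cube hy.1))
  norm_num at h; linarith

theorem sin_le_taylor_five {x : ℝ} (hx : 0 ≤ x) : sin x ≤ x - x ^ 3 / 6 + x ^ 5 / 120 := by
  have h := le_of_hasDerivAt_nonneg (f := fun x : ℝ => x - x ^ 3 / 6 + x ^ 5 / 120 - sin x)
    (f' := fun x => 1 - x ^ 2 / 2 + x ^ 4 / 24 - cos x) hx
    (fun y _ => by
      refine HasDerivAt.congr_deriv ((((hasDerivAt_id y).sub ((hasDerivAt_pow 3 y).div_const 6)).add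
        ((hasDerivAt_pow 5 y).div_const 120)).sub (hasDerivAt_sin y)) ?_
      push_cast; ring)
    (fun y hy => sub_nonneg.2 (cos_le_taylor_four hy.1))
  norm_num at h; linarith

theorem taylor_six_le_cos {x : ℝ} (hx : 0 ≤ x) :
    1 - x ^ 2 / 2 + x ^ 4 / 24 - x ^ 6 / 720 ≤ cos x := by
  have h := le_of_hasDerivAt_nonneg
    (f := fun x : ℝ => cos x - (1 - x ^ 2 / 2 + x ^ 4 / 24 - x ^ 6 / 720))
    (f' := fun x => x - x ^ 3 / 6 + x ^ 5 / 120 - sin x) hx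
    (fun y _ => by
      refine HasDerivAt.congr_deriv ((hasDerivAt_cos y).sub (((((hasDerivAt_pow 2 y).div_const 2).const_sub 1).add
        ((hasDerivAt_pow 4 y).div_const 24)).sub ((hasDerivAt_pow 6 y).div_const 720))) ?_
      push_cast; ring)
    (fun y hy => sub_nonneg.2 (sin_le_taylor_five hy.1))
  norm_num at h; linarith

theorem taylor_seven_le_sin {x : ℝ} (hx : 0 ≤ x) :
    x - x ^ 3 / 6 + x ^ 5 / 120 - x ^ 7 / 5040 ≤ sin x := by
  have h := le_of_hasDerivAt_nonneg
    (f := fun x : ℝ => sin x - (x - x ^ 3 / 6 + x ^ 5 / 120 - x ^ 7 / 5040))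
    (f' := fun x => cos x - (1 - x ^ 2 / 2 + x ^ 4 / 24 - x ^ 6 / 720)) hx
    (fun y _ => by
      refine HasDerivAt.congr_deriv ((hasDerivAt_sin y).sub ((((hasDerivAt_id y).sub ((hasDerivAt_pow 3 y).div_const 6)).add
        ((hasDerivAt_pow 5 y).div_const 120)).sub ((hasDerivAt_pow 7 y).div_const 5040))) ?_
      push_cast; ring)
    (fun y hy => sub_nonneg.2 (taylor_six_le_cos hy.1))
  norm_num at h; linarith

theorem cos_le_taylor_eight {x : ℝ} (hx : 0 ≤ x) :
    cos x ≤ 1 - x ^ 2 / 2 + x ^ 4 / 24 - x ^ 6 / 720 + x ^ 8 / 40320 := by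
  have h := le_of_hasDerivAt_nonneg
    (f := fun x : ℝ => 1 - x ^ 2 / 2 + x ^ 4 / 24 - x ^ 6 / 720 + x ^ 8 / 40320 - cos x)
    (f' := fun x => sin x - (x - x ^ 3 / 6 + x ^ 5 / 120 - x ^ 7 / 5040)) hx
    (fun y _ => by
      refine HasDerivAt.congr_deriv (((((((hasDerivAt_pow 2 y).div_const 2).const_sub 1).add
        ((hasDerivAt_pow 4 y).div_const 24)).sub ((hasDerivAt_pow 6 y).div_const 720)).add
        ((hasDerivAt_pow 8 y).div_const 40320)).sub (hasDerivAt_cos y)) ?_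
      push_cast; ring)
    (fun y hy => sub_nonneg.2 (taylor_seven_le_sin hy.1))
  norm_num at h; linarith

theorem sq_lt_of_lt_pi_div_two {x : ℝ} (h0 : 0 ≤ x) (hx : x < π / 2) : x ^ 2 < 5 / 2 := by
  have := pi_lt_d2
  nlinarith

/-- This is the comparison of derivatives behind `div_le_twoNegLogCos`: with D the squared factor,
(x²/D)' = 2x(1 + x⁴/60 + x⁶/160)/D², while V' = 2 sin x / cos x. -/
theorem cos_mul_le_sin_mul {x : ℝ} (h0 : 0 ≤ x) (hx : x < π / 2) :
    cos x * (x * (1 + x ^ 4 / 60 + x ^ 6 / 160)) ≤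
      sin x * (1 - x ^ 2 / 6 - x ^ 4 / 60 - x ^ 6 / 320) ^ 2 := by
  have hq := sq_lt_of_lt_pi_div_two h0 hx
  have hq0 : 0 ≤ x ^ 2 := sq_nonneg x
  have h1 : cos x * (x * (1 + x ^ 4 / 60 + x ^ 6 / 160)) ≤
      (1 - x ^ 2 / 2 + x ^ 4 / 24 - x ^ 6 / 720 + x ^ 8 / 40320) *
        (x * (1 + x ^ 4 / 60 + x ^ 6 / 160)) :=
    mul_le_mul_of_nonneg_right (cos_le_taylor_eight h0) (by positivity)
  have h2 : (x - x ^ 3 / 6 + x ^ 5 / 120 - x ^ 7 / 5040) *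
      (1 - x ^ 2 / 6 - x ^ 4 / 60 - x ^ 6 / 320) ^ 2 ≤
      sin x * (1 - x ^ 2 / 6 - x ^ 4 / 60 - x ^ 6 / 320) ^ 2 :=
    mul_le_mul_of_nonneg_right (taylor_seven_le_sin h0) (sq_nonneg _)
  refine h1.trans (le_trans ?_ h2)
  -- The difference of the two Taylor sides is x⁷ times this polynomial in q = x², grouped so that
  -- each bracket is nonnegative for q < 5/2.
  have key : ∀ q : ℝ, 0 ≤ q → q < 5 / 2 → 0 ≤ 11/15120 + q * (467/120960 - q * (649/1814400)
      + q ^ 2 * (3427/290304000 - q * (683/580608000))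
      + q ^ 4 * (47/774144000 - q * (1/516096000))) := by
    intro q h0 h1
    have e1 : 0 ≤ 467/120960 - q * (649/1814400) := by linarith
    have e2 : 0 ≤ 3427/290304000 - q * (683/580608000) := by linarith
    have e3 : 0 ≤ 47/774144000 - q * (1/516096000) := by linarith
    positivity
  have := mul_nonneg (pow_nonneg h0 7) (key (x ^ 2) hq0 hq)
  rw [← sub_nonneg]
  refine this.trans_eq ?_
  ring

/-- `2 (- log (cos x))`, so that `cos x ^ s = exp (- s * twoNegLogCos x / 2)`. -/
noncomputable def twoNegLogCos (x : ℝ) : ℝ := -2 * log (cos x)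

theorem hasDerivAt_twoNegLogCos {x : ℝ} (hc : cos x ≠ 0) :
    HasDerivAt twoNegLogCos (2 * sin x / cos x) x := by
  refine HasDerivAt.congr_deriv (((hasDerivAt_cos x).log hc).const_mul (-2)) ?_
  ring

theorem exp_neg_mul_twoNegLogCos {x : ℝ} (s : ℝ) (hc : 0 < cos x) :
    exp (-s * twoNegLogCos x / 2) = cos x ^ s := by
  rw [rpow_def_of_pos hc, twoNegLogCos]
  congr 1
  ring

/-- The expansion is x²/V = 1 - x²/6 - x⁴/60 - (5/1512)x⁶ - ...; lowering the last coefficient to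
1/320 enlarges the denominator. Both sides vanish at 0, so derivatives are compared. -/
theorem div_le_twoNegLogCos {x : ℝ} (h0 : 0 ≤ x) (hx : x < π / 2) :
    x ^ 2 / (1 - x ^ 2 / 6 - x ^ 4 / 60 - x ^ 6 / 320) ≤ twoNegLogCos x := by
  have hpos : ∀ y ∈ Icc 0 x, 0 < 1 - y ^ 2 / 6 - y ^ 4 / 60 - y ^ 6 / 320 := by
    intro y hy
    have hq := sq_lt_of_lt_pi_div_two hy.1 (hy.2.trans_lt hx)
    have hq0 : 0 ≤ y ^ 2 := sq_nonneg y
    nlinarith [mul_nonneg hq0 hq0, mul_nonneg (mul_nonneg hq0 hq0) hq0,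
      mul_nonneg hq0 (sub_nonneg.2 hq.le), mul_nonneg (mul_nonneg hq0 hq0) (sub_nonneg.2 hq.le)]
  have hcos : ∀ y ∈ Icc 0 x, 0 < cos y := fun y hy =>
    cos_pos_of_mem_Ioo ⟨by linarith [hy.1, pi_pos], by linarith [hy.2]⟩
  have h := le_of_hasDerivAt_nonneg
    (f := fun y => twoNegLogCos y - y ^ 2 / (1 - y ^ 2 / 6 - y ^ 4 / 60 - y ^ 6 / 320))
    (f' := fun y => 2 / (cos y * (1 - y ^ 2 / 6 - y ^ 4 / 60 - y ^ 6 / 320) ^ 2) *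
      (sin y * (1 - y ^ 2 / 6 - y ^ 4 / 60 - y ^ 6 / 320) ^ 2 -
        cos y * (y * (1 + y ^ 4 / 60 + y ^ 6 / 160)))) h0
    (fun y hy => by
      have hp := (hpos y hy).ne'
      have hc := (hcos y hy).ne'
      refine HasDerivAt.congr_deriv ((hasDerivAt_twoNegLogCos hc).sub ((hasDerivAt_pow 2 y).div
        (((((hasDerivAt_pow 2 y).div_const 6).const_sub 1).sub
          ((hasDerivAt_pow 4 y).div_const 60)).sub ((hasDerivAt_pow 6 y).div_const 320)) hp)) ?_
      simp only [Nat.cast_ofNat, Nat.add_one_sub_one]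
      generalize hD : 1 - y ^ 2 / 6 - y ^ 4 / 60 - y ^ 6 / 320 = D at *
      field_simp
      rw [← hD]
      ring)
    (fun y hy => by
      have hp := hpos y hy
      have hc := hcos y hy
      exact mul_nonneg (by positivity)
        (sub_nonneg.2 (cos_mul_le_sin_mul hy.1 (hy.2.trans_lt hx))))
  simp [twoNegLogCos] at h
  simpa [twoNegLogCos] using h

theorem twoNegLogCos_pos {x : ℝ} (h0 : 0 < x) (hx : x < π / 2) : 0 < twoNegLogCos x := by
  have hc : 0 < cos x := cos_pos_of_mem_Ioo ⟨by linarith, hx⟩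
  have hc1 : cos x < 1 := by
    rw [← cos_zero]; exact cos_lt_cos_of_nonneg_of_le_pi_div_two le_rfl hx.le h0
  have := log_neg hc hc1
  unfold twoNegLogCos; linarith

/-- Written in y = 1 - cos x so that it integrates explicitly against s c^(s-1) dc. Since x² = 2y +
y²/3 + ..., the sum x²/60 + x⁴/320 begins y/30 + (13/720)y², and 7/400 lies just below 13/720. -/
theorem le_inv_sq_sub_inv_twoNegLogCos {x : ℝ} (h0 : 0 < x) (hx : x < π / 2) :
    1 / 6 + (1 - cos x) / 30 + 7 / 400 * (1 - cos x) ^ 2 ≤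
      1 / x ^ 2 - 1 / twoNegLogCos x := by
  have hq := sq_lt_of_lt_pi_div_two h0.le hx
  have hq0 : 0 < x ^ 2 := by positivity
  have hV := twoNegLogCos_pos h0 hx
  have hpos : 0 < 1 - x ^ 2 / 6 - x ^ 4 / 60 - x ^ 6 / 320 := by
    nlinarith [mul_pos hq0 hq0, mul_pos (mul_pos hq0 hq0) hq0,
      mul_pos hq0 (sub_pos.2 hq), mul_pos (mul_pos hq0 hq0) (sub_pos.2 hq)]
  have h1 : 1 / twoNegLogCos x ≤ 1 / (x ^ 2 / (1 - x ^ 2 / 6 - x ^ 4 / 60 - x ^ 6 / 320)) :=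
    one_div_le_one_div_of_le (by positivity) (div_le_twoNegLogCos h0.le hx)
  have h2 : 1 / (x ^ 2 / (1 - x ^ 2 / 6 - x ^ 4 / 60 - x ^ 6 / 320)) =
      1 / x ^ 2 - (1 / 6 + x ^ 2 / 60 + x ^ 4 / 320) := by
    generalize hD : 1 - x ^ 2 / 6 - x ^ 4 / 60 - x ^ 6 / 320 = D at *
    field_simp
    rw [← hD]; ring
  have hy0 : 0 ≤ 1 - cos x := by linarith [cos_le_one x]
  have hy1 := taylor_six_le_cos h0.le
  have hy2 : 1 - cos x ≤ x ^ 2 / 2 - x ^ 4 / 24 + x ^ 6 / 720 := by linarith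
  have hy3 : (1 - cos x) ^ 2 ≤ (x ^ 2 / 2 - x ^ 4 / 24 + x ^ 6 / 720) ^ 2 :=
    pow_le_pow_left₀ hy0 hy2 2
  have key : ∀ q : ℝ, 0 ≤ q → q < 5 / 2 →
      0 ≤ q / 60 + q ^ 2 / 320 - ((q / 2 - q ^ 2 / 24 + q ^ 3 / 720) / 30 +
        7 / 400 * (q / 2 - q ^ 2 / 24 + q ^ 3 / 720) ^ 2) := by
    intro q h0 h1
    have : 0 ≤ q ^ 2 * ((1 / 320 + 1 / 720 - 7 / 1600) + q * (7 / 9600 - 1 / 21600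
        - q * (7 / 400) * (1 / 576 + 1 / 720)) + (7 / 400) * q ^ 3 * (1 / 12 / 720 - q / 720 ^ 2)) := by
      have e1 : 0 ≤ 7 / 9600 - 1 / 21600 - q * (7 / 400) * (1 / 576 + 1 / 720) := by linarith
      have e2 : 0 ≤ 1 / 12 / 720 - q / 720 ^ 2 := by linarith
      have e3 : (0 : ℝ) ≤ 1 / 320 + 1 / 720 - 7 / 1600 := by norm_num
      positivity
    refine this.trans_eq ?_
    ring
  have h3 := key (x ^ 2) hq0.le hq
  have h4 : (x ^ 2) ^ 2 = x ^ 4 := by ring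
  have h5 : (x ^ 2) ^ 3 = x ^ 6 := by ring
  rw [h4, h5] at h3
  linarith

theorem sq_le_twoNegLogCos {x : ℝ} (h0 : 0 < x) (hx : x < π / 2) : x ^ 2 ≤ twoNegLogCos x := by
  have h := le_inv_sq_sub_inv_twoNegLogCos h0 hx
  have hV := twoNegLogCos_pos h0 hx
  have hc := cos_le_one x
  have h1 : 1 / twoNegLogCos x ≤ 1 / x ^ 2 := by nlinarith [sq_nonneg (1 - cos x)]
  exact le_of_one_div_le_one_div hV h1

end Trigonometric

/-! ### The Gaussian gain on (0, π/2) for the weight t⁻³. -/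

section GaussianSide
open Real Set Filter Topology

theorem integrableOn_Ioi_inv_cube {x : ℝ} (hx : 0 < x) :
    IntegrableOn (fun r : ℝ => (r ^ 3)⁻¹) (Ioi x) := by
  refine (integrableOn_Ioi_rpow_of_lt (a := -3) (by norm_num) hx).congr_fun (fun r hr => ?_)
    measurableSet_Ioi
  have hr : 0 < r := hx.trans hr
  change r ^ (-3 : ℝ) = (r ^ 3)⁻¹
  rw [rpow_neg hr.le]
  norm_cast

theorem integral_Ioi_inv_cube {x : ℝ} (hx : 0 < x) :
    ∫ r in Ioi x, (r ^ 3)⁻¹ = 1 / (2 * x ^ 2) := by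
  have h := integral_Ioi_rpow_of_lt (a := -3) (by norm_num) hx
  rw [setIntegral_congr_fun measurableSet_Ioi (g := fun r : ℝ => r ^ (-3 : ℝ)), h]
  · have : (-3 + 1 : ℝ) = -(2 : ℕ) := by norm_num
    rw [this, rpow_neg hx.le, rpow_natCast]
    have := hx.ne'
    field_simp
    norm_num
  · intro r hr
    have hr : 0 < r := hx.trans hr
    change (r ^ 3)⁻¹ = r ^ (-3 : ℝ)
    rw [rpow_neg hr.le]
    norm_cast

theorem integrableOn_Ioi_gaussian_mul_inv_cube {s x : ℝ} (hs : 0 ≤ s) (hx : 0 < x) :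
    IntegrableOn (fun r : ℝ => exp (-s * r ^ 2 / 2) * (r ^ 3)⁻¹) (Ioi x) := by
  refine (integrableOn_Ioi_inv_cube hx).mono' (by fun_prop) ?_
  refine (ae_restrict_iff' measurableSet_Ioi).2 (Eventually.of_forall fun r hr => ?_)
  have hr : 0 < r := hx.trans hr
  rw [norm_of_nonneg (by positivity)]
  refine mul_le_of_le_one_left (by positivity) (exp_le_one_iff.2 ?_)
  have : 0 ≤ s * r ^ 2 := by positivity
  linarith

theorem continuousOn_gaussian_mul_inv_cube (s : ℝ) :
    ContinuousOn (fun r : ℝ => exp (-s * r ^ 2 / 2) * (r ^ 3)⁻¹) (Ioi 0) := by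
  refine ContinuousOn.mul (by fun_prop) (ContinuousOn.inv₀ (by fun_prop) fun r hr => ?_)
  have : (0 : ℝ) < r := hr
  positivity

/-- The tail `∫_x^∞ exp (-s r² / 2) r⁻³ dr`. -/
noncomputable def gaussTail (s x : ℝ) : ℝ :=
  ∫ r in Ioi x, exp (-s * r ^ 2 / 2) * (r ^ 3)⁻¹

theorem gaussTail_nonneg {s x : ℝ} (hx : 0 < x) : 0 ≤ gaussTail s x :=
  setIntegral_nonneg measurableSet_Ioi fun r hr => by
    have : 0 < r := hx.trans hr
    positivity

theorem hasDerivAt_gaussTail {s x : ℝ} (hs : 0 ≤ s) (hx : 0 < x) :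
    HasDerivAt (gaussTail s) (-(exp (-s * x ^ 2 / 2) * (x ^ 3)⁻¹)) x := by
  have hcont := (continuousOn_gaussian_mul_inv_cube s)
  have h1 : HasDerivAt (fun y => ∫ r in (1 : ℝ)..y, exp (-s * r ^ 2 / 2) * (r ^ 3)⁻¹)
      (exp (-s * x ^ 2 / 2) * (x ^ 3)⁻¹) x := by
    refine intervalIntegral.integral_hasDerivAt_right ?_ ?_ ?_
    · refine ContinuousOn.intervalIntegrable (hcont.mono fun y hy => ?_)
      exact (lt_min one_pos hx).trans_le hy.1
    · exact hcont.stronglyMeasurableAtFilter isOpen_Ioi x hx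
    · exact hcont.continuousAt (Ioi_mem_nhds hx)
  refine (h1.const_sub (gaussTail s 1)).congr_of_eventuallyEq ?_
  filter_upwards [Ioi_mem_nhds hx] with y hy
  have := intervalIntegral.integral_interval_add_Ioi
    (integrableOn_Ioi_gaussian_mul_inv_cube hs one_pos)
    (integrableOn_Ioi_gaussian_mul_inv_cube hs (x := y) hy)
  unfold gaussTail
  linarith

/-- In the variable w = r² the Gaussian is exp(-sw/2), which becomes cos^s at w = V. -/
theorem hasDerivAt_gaussTail_sqrt {s w : ℝ} (hs : 0 ≤ s) (hw : 0 < w) :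
    HasDerivAt (fun w => gaussTail s √w) (-(exp (-s * w / 2) / (2 * w ^ 2))) w := by
  refine ((hasDerivAt_gaussTail hs (sqrt_pos.2 hw)).comp w (hasDerivAt_sqrt hw.ne')).congr_deriv ?_
  rw [sq_sqrt hw.le]
  have h1 : √w ^ 3 = w * √w := by
    rw [pow_succ, sq_sqrt hw.le]
  have h2 : √w ≠ 0 := (sqrt_pos.2 hw).ne'
  have h3 : √w ^ 2 = w := sq_sqrt hw.le
  rw [h1]
  field_simp
  linear_combination h3

/-- On [x, y] the Gaussian is smallest at y, and r⁻³ integrates exactly. -/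
theorem le_gaussTail_sub {s x y : ℝ} (hs : 0 ≤ s) (hx : 0 < x) (hxy : x ≤ y) :
    exp (-s * y ^ 2 / 2) * ((1 / x ^ 2 - 1 / y ^ 2) / 2) ≤ gaussTail s x - gaussTail s y := by
  have hy := hx.trans_le hxy
  unfold gaussTail
  rw [intervalIntegral.integral_Ioi_sub_Ioi (integrableOn_Ioi_gaussian_mul_inv_cube hs hx) hxy]
  have h1 : ∫ r in x..y, (r ^ 3)⁻¹ = (1 / x ^ 2 - 1 / y ^ 2) / 2 := by
    rw [← intervalIntegral.integral_Ioi_sub_Ioi (integrableOn_Ioi_inv_cube hx) hxy,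
      integral_Ioi_inv_cube hx, integral_Ioi_inv_cube hy]
    field_simp
  rw [← h1, ← intervalIntegral.integral_const_mul]
  have hsub : uIcc x y ⊆ Ioi 0 := fun r hr => (lt_min hx hy).trans_le hr.1
  refine intervalIntegral.integral_mono_on hxy ?_ ?_ fun r hr => ?_
  · refine ContinuousOn.intervalIntegrable
      (ContinuousOn.mul (by fun_prop) (ContinuousOn.inv₀ (by fun_prop) fun r hr => ?_))
    have : 0 < r := hsub hr
    positivity
  · exact ContinuousOn.intervalIntegrable ((continuousOn_gaussian_mul_inv_cube s).mono hsub)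
  · have hr0 : 0 < r := hx.trans_le hr.1
    have hr1 : r ^ 2 ≤ y ^ 2 := pow_le_pow_left₀ hr0.le hr.2 2
    gcongr ?_ * _
    refine exp_le_exp.2 ?_
    nlinarith

/-- Half the primitive of `s c ^ (s - 1) (1/6 + (1 - c)/30 + 7/400 (1 - c)²)`. -/
noncomputable def excessBound (s c : ℝ) : ℝ :=
  c ^ s * ((1 / 6 + 1 / 30 + 7 / 400) - s / (s + 1) * (1 / 30 + 7 / 200) * c +
    s / (s + 2) * (7 / 400) * c ^ 2) / 2

theorem hasDerivAt_excessBound {s c : ℝ} (hs : 0 < s) (hc : 0 < c) :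
    HasDerivAt (excessBound s)
      (s * c ^ s / c * (1 / 6 + (1 - c) / 30 + 7 / 400 * (1 - c) ^ 2) / 2) c := by
  refine (((hasDerivAt_rpow_const (p := s) (Or.inl hc.ne')).mul
    ((((hasDerivAt_id c).const_mul (s / (s + 1) * (1 / 30 + 7 / 200))).const_sub
      (1 / 6 + 1 / 30 + 7 / 400)).add
      ((hasDerivAt_pow 2 c).const_mul (s / (s + 2) * (7 / 400))))).div_const 2).congr_deriv ?_
  have h1 : s + 1 ≠ 0 := by positivity
  have h2 : s + 2 ≠ 0 := by positivity
  rw [rpow_sub_one hc.ne']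
  simp only [Pi.add_apply, id]
  field_simp
  ring

theorem continuous_excessBound {s : ℝ} (hs : 0 ≤ s) : Continuous (excessBound s) := by
  have := continuous_rpow_const (q := s) hs
  unfold excessBound
  fun_prop

/-- Integrated form of `1 / x² - 1 / V ≥ 1/6 + (1 - cos x)/30 + 7/400 (1 - cos x)²`, where
`cos x = exp (- V / 2)`, before letting the right end point tend to `π / 2`. -/
theorem integral_cos_rpow_add_excessBound_le_aux {s a b : ℝ} (hs : 0 < s) (ha : 0 < a)
    (hab : a ≤ b) (hb : b < π / 2) :
    (∫ t in a..b, cos t ^ s * (t ^ 3)⁻¹) + excessBound s (cos a) ≤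
      gaussTail s a + excessBound s (cos b) := by
  have hpos : ∀ t ∈ Icc a b, 0 < t ∧ t < π / 2 ∧ 0 < cos t ∧ 0 < twoNegLogCos t := by
    intro t ht
    have h0 : 0 < t := ha.trans_le ht.1
    have h1 : t < π / 2 := ht.2.trans_lt hb
    exact ⟨h0, h1, cos_pos_of_mem_Ioo ⟨by linarith, h1⟩, twoNegLogCos_pos h0 h1⟩
  -- The first two terms together have derivative -cos^s/t³ - ½ s cos^s tan t (1/t² - 1/V): the V⁻²
  -- terms cancel. Subtracting `excessBound` leaves only the gap in
  -- `le_inv_sq_sub_inv_twoNegLogCos`, so M' ≤ -cos^s t⁻³.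
  let M : ℝ → ℝ := fun t => gaussTail s √(twoNegLogCos t) +
    cos t ^ s * (1 / t ^ 2 - 1 / twoNegLogCos t) / 2 - excessBound s (cos t)
  let D : ℝ → ℝ := fun t => -(cos t ^ s / t ^ 3) - s * cos t ^ s * (sin t / cos t) / 2 *
    ((1 / t ^ 2 - 1 / twoNegLogCos t) -
      (1 / 6 + (1 - cos t) / 30 + 7 / 400 * (1 - cos t) ^ 2))
  have hM : ∀ t ∈ Icc a b, HasDerivAt M (D t) t := by
    intro t ht
    obtain ⟨h0, h1, hc, hV⟩ := hpos t ht
    have d1 : HasDerivAt (fun t => cos t ^ s) (-(s * cos t ^ s * (sin t / cos t))) t := by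
      refine ((hasDerivAt_cos t).rpow_const (p := s) (Or.inl hc.ne')).congr_deriv ?_
      rw [rpow_sub_one hc.ne']
      ring
    have dV := hasDerivAt_twoNegLogCos hc.ne'
    have d2 := (hasDerivAt_gaussTail_sqrt hs.le hV).comp t dV
    have d3 : HasDerivAt (fun t => 1 / t ^ 2 - 1 / twoNegLogCos t)
        (-(2 / t ^ 3) + 2 * (sin t / cos t) / twoNegLogCos t ^ 2) t := by
      refine (((hasDerivAt_const t (1 : ℝ)).div (hasDerivAt_pow 2 t) (by positivity)).sub
        ((hasDerivAt_const t (1 : ℝ)).div dV hV.ne')).congr_deriv ?_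
      field_simp
      push_cast
      ring
    have d4 := (hasDerivAt_excessBound hs hc).comp t (hasDerivAt_cos t)
    refine ((d2.add ((d1.mul d3).div_const 2)).sub d4).congr_deriv ?_
    rw [exp_neg_mul_twoNegLogCos s hc]
    simp only [D]
    field_simp
    ring
  have hMint : (∫ t in a..b, cos t ^ s * (t ^ 3)⁻¹) ≤ (-M b) - (-M a) := by
    refine intervalIntegral.integral_le_sub_of_hasDeriv_right_of_le (g' := fun t => -D t) hab
      (fun t ht => (hM t ht).continuousAt.neg.continuousWithinAt)
      (fun t ht => (hM t (Ioo_subset_Icc_self ht)).neg.hasDerivWithinAt) ?_ ?_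
    · refine ContinuousOn.integrableOn_Icc (ContinuousOn.mul ?_
        (ContinuousOn.inv₀ (by fun_prop) fun t ht => ?_))
      · exact (continuous_cos.continuousOn).rpow_const fun t ht => Or.inr hs.le
      · have := (hpos t ht).1
        positivity
    · intro t ht
      obtain ⟨h0, h1, hc, hV⟩ := hpos t (Ioo_subset_Icc_self ht)
      have hR := le_inv_sq_sub_inv_twoNegLogCos h0 h1
      have hsin : 0 < sin t := sin_pos_of_pos_of_lt_pi h0 (by linarith [pi_pos])
      have : 0 ≤ s * cos t ^ s * (sin t / cos t) / 2 *
        ((1 / t ^ 2 - 1 / twoNegLogCos t) -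
          (1 / 6 + (1 - cos t) / 30 + 7 / 400 * (1 - cos t) ^ 2)) :=
        mul_nonneg (by positivity) (by linarith)
      simp only [D]
      rw [← div_eq_mul_inv]
      linarith
  have hMb : -excessBound s (cos b) ≤ M b := by
    obtain ⟨h0, h1, hc, hV⟩ := hpos b (right_mem_Icc.2 hab)
    have := gaussTail_nonneg (s := s) (sqrt_pos.2 hV)
    have h2 : 0 ≤ 1 / b ^ 2 - 1 / twoNegLogCos b :=
      sub_nonneg.2 (one_div_le_one_div_of_le (by positivity) (sq_le_twoNegLogCos h0 h1))
    have h3 : 0 ≤ cos b ^ s * (1 / b ^ 2 - 1 / twoNegLogCos b) / 2 := by positivity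
    simp only [M]
    linarith
  -- The Gaussian mass between a and √V(a) pays for the boundary term cos^s (1/a² - 1/V)/2.
  have hMa : M a ≤ gaussTail s a - excessBound s (cos a) := by
    obtain ⟨h0, h1, hc, hV⟩ := hpos a (left_mem_Icc.2 hab)
    have h2 := le_gaussTail_sub hs.le h0 (le_sqrt_of_sq_le (sq_le_twoNegLogCos h0 h1))
    rw [sq_sqrt hV.le, exp_neg_mul_twoNegLogCos s hc] at h2
    simp only [M]
    linarith
  linarith

/-- V blows up at π/2, so this endpoint is reached only as a limit; there `excessBound` vanishes. -/
theorem integral_cos_rpow_add_excessBound_le {s a : ℝ} (hs : 0 < s) (ha : 0 < a)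
    (ha' : a < π / 2) :
    (∫ t in a..(π / 2), cos t ^ s * (t ^ 3)⁻¹) + excessBound s (cos a) ≤ gaussTail s a := by
  have hint : IntervalIntegrable (fun t => cos t ^ s * (t ^ 3)⁻¹) volume a (π / 2) := by
    refine ContinuousOn.intervalIntegrable (ContinuousOn.mul
      ((continuous_cos.continuousOn).rpow_const fun t ht => Or.inr hs.le)
        (ContinuousOn.inv₀ (by fun_prop) fun t ht => ?_))
    have : 0 < t := (lt_min ha (by positivity)).trans_le ht.1
    positivity
  have h1 : Tendsto (fun b => (∫ t in a..b, cos t ^ s * (t ^ 3)⁻¹) + excessBound s (cos a))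
      (𝓝[<] (π / 2)) (𝓝 ((∫ t in a..(π / 2), cos t ^ s * (t ^ 3)⁻¹) + excessBound s (cos a))) := by
    refine Tendsto.add_const _ ?_
    have h := intervalIntegral.continuousOn_primitive_interval' hint left_mem_uIcc
    rw [uIcc_of_le ha'.le] at h
    exact (h (π / 2) (right_mem_Icc.2 ha'.le)).mono_left
      (nhdsWithin_le_of_mem (mem_of_superset (Ioo_mem_nhdsLT ha') Ioo_subset_Icc_self))
  have h2 : Tendsto (fun b => gaussTail s a + excessBound s (cos b))
      (𝓝[<] (π / 2)) (𝓝 (gaussTail s a)) := by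
    have h := ((continuous_excessBound hs.le).comp continuous_cos).tendsto (π / 2)
    have h0 : excessBound s 0 = 0 := by simp [excessBound, zero_rpow hs.ne']
    simp only [Function.comp, cos_pi_div_two, h0] at h
    simpa using (h.mono_left nhdsWithin_le_nhds).const_add (gaussTail s a)
  refine le_of_tendsto_of_tendsto h1 h2 ?_
  filter_upwards [Ioo_mem_nhdsLT ha'] with b hb
  exact integral_cos_rpow_add_excessBound_le_aux hs ha hb.1.le hb.2

end GaussianSide

/-! ### Integrability and sign of the difference, and reduction to the weight t⁻³. -/

section Difference
open Real Set Filter Topology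

theorem exp_neg_le_quadratic {x : ℝ} (hx : 0 ≤ x) : exp (-x) ≤ 1 - x + x ^ 2 / 2 := by
  have h := le_of_hasDerivAt_nonneg (f := fun x : ℝ => 1 - x + x ^ 2 / 2 - exp (-x))
    (f' := fun x => -x + 1 - 2 + 2 * x + exp (-x)) hx
    (fun y _ => by
      refine ((((hasDerivAt_id y).const_sub 1).add ((hasDerivAt_pow 2 y).div_const 2)).sub
        ((hasDerivAt_neg y).exp)).congr_deriv ?_
      push_cast; ring)
    (fun y hy => by linarith [add_one_le_exp (-y)])
  norm_num at h; linarith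

/-- `exp (-s t² / 2) - |cos t| ^ s`. -/
noncomputable def gaussCosDiff (s t : ℝ) : ℝ := exp (-s * t ^ 2 / 2) - |cos t| ^ s

theorem continuous_gaussCosDiff {s : ℝ} (hs : 0 ≤ s) : Continuous (gaussCosDiff s) := by
  have h := (continuous_rpow_const (q := s) hs).comp continuous_cos.abs
  unfold gaussCosDiff
  exact Continuous.sub (by fun_prop) h

theorem abs_cos_rpow_le_one {s : ℝ} (hs : 0 ≤ s) (t : ℝ) : |cos t| ^ s ≤ 1 :=
  rpow_le_one (abs_nonneg _) (abs_cos_le_one t) hs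

theorem exp_neg_mul_sq_le_one {s : ℝ} (hs : 0 ≤ s) (t : ℝ) : exp (-s * t ^ 2 / 2) ≤ 1 := by
  have : 0 ≤ s * t ^ 2 := by positivity
  exact exp_le_one_iff.2 (by linarith)

theorem abs_gaussCosDiff_le_one {s : ℝ} (hs : 0 ≤ s) (t : ℝ) : |gaussCosDiff s t| ≤ 1 := by
  have h1 := abs_cos_rpow_le_one hs t
  have h2 := exp_neg_mul_sq_le_one hs t
  have h3 : 0 ≤ |cos t| ^ s := by positivity
  have h4 := (exp_pos (-s * t ^ 2 / 2)).le
  unfold gaussCosDiff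
  rw [abs_le]; constructor <;> linarith

theorem exp_neg_mul_sq_eq_rpow (s t : ℝ) :
    exp (-s * t ^ 2 / 2) = exp (-t ^ 2 / 2) ^ s := by
  rw [← exp_mul]; congr 1; ring

theorem gaussCosDiff_nonneg_of_le {s t : ℝ} (hs : 0 ≤ s) (h : |cos t| ≤ exp (-t ^ 2 / 2)) :
    0 ≤ gaussCosDiff s t := by
  rw [gaussCosDiff, exp_neg_mul_sq_eq_rpow]
  exact sub_nonneg.2 (rpow_le_rpow (abs_nonneg _) h hs)

theorem gaussCosDiff_nonpos_of_le {s t : ℝ} (hs : 0 ≤ s) (h : exp (-t ^ 2 / 2) ≤ |cos t|) :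
    gaussCosDiff s t ≤ 0 := by
  rw [gaussCosDiff, exp_neg_mul_sq_eq_rpow]
  exact sub_nonpos.2 (rpow_le_rpow (exp_pos _).le h hs)

theorem abs_cos_le_exp {t : ℝ} (h0 : 0 ≤ t) (h1 : t ≤ π / 2) : |cos t| ≤ exp (-t ^ 2 / 2) := by
  rw [abs_of_nonneg (cos_nonneg_of_mem_Icc ⟨by linarith [pi_pos], h1⟩)]
  rcases h0.eq_or_lt with rfl | h0
  · simp
  rcases h1.eq_or_lt with rfl | h1
  · rw [cos_pi_div_two]; positivity
  have hc : 0 < cos t := cos_pos_of_mem_Ioo ⟨by linarith, h1⟩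
  have h := exp_neg_mul_twoNegLogCos 1 hc
  rw [rpow_one] at h
  rw [← h]
  exact exp_le_exp.2 (by linarith [sq_le_twoNegLogCos h0 h1])

theorem gaussCosDiff_nonneg {s t : ℝ} (hs : 0 ≤ s) (h0 : 0 ≤ t) (h1 : t ≤ π / 2) :
    0 ≤ gaussCosDiff s t :=
  gaussCosDiff_nonneg_of_le hs (abs_cos_le_exp h0 h1)

/-- Bernoulli's inequality gives |cos t|^s ≥ 1 - st²/2, which matches exp(-st²/2) up to order t⁴.
This order permits weights t^q with q > -5. -/
theorem gaussCosDiff_le {s : ℝ} (hs : 1 ≤ s) (t : ℝ) :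
    gaussCosDiff s t ≤ s ^ 2 / 8 * t ^ 4 := by
  have e1 := exp_neg_le_quadratic (x := s * t ^ 2 / 2) (by positivity)
  have e2 := one_add_mul_self_le_rpow_one_add (s := |cos t| - 1) (p := s)
    (by linarith [abs_nonneg (cos t)]) hs
  have e3 := one_sub_sq_div_two_le_cos (x := t)
  have e4 := le_abs_self (cos t)
  have e5 : -s * t ^ 2 / 2 = -(s * t ^ 2 / 2) := by ring
  have e6 : 1 + (|cos t| - 1) = |cos t| := by ring
  have e7 : s * (-(t ^ 2 / 2)) ≤ s * (|cos t| - 1) :=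
    mul_le_mul_of_nonneg_left (by linarith) (by linarith)
  rw [e6] at e2
  rw [gaussCosDiff, e5]
  nlinarith

theorem integrableOn_gaussCosDiff_mul_rpow {s q : ℝ} (hs : 1 ≤ s) (hq : -5 < q) (hq' : q < -1) :
    IntegrableOn (fun t => gaussCosDiff s t * t ^ q) (Ioi 0) := by
  have hpi : (0 : ℝ) < π / 2 := by positivity
  have hmeas : Measurable (fun t => gaussCosDiff s t * t ^ q) :=
    (continuous_gaussCosDiff (by linarith)).measurable.mul (measurable_id.pow_const q)
  rw [← Ioc_union_Ioi_eq_Ioi hpi.le]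
  refine IntegrableOn.union ?_ ?_
  · have h : IntegrableOn (fun t : ℝ => s ^ 2 / 8 * t ^ (4 + q)) (Ioc 0 (π / 2)) :=
      ((intervalIntegral.intervalIntegrable_rpow' (by linarith)).1).const_mul _
    refine h.mono' hmeas.aestronglyMeasurable
      ((ae_restrict_iff' measurableSet_Ioc).2 (Eventually.of_forall fun t ht => ?_))
    have h0 : 0 ≤ t ^ q := rpow_nonneg ht.1.le _
    rw [norm_of_nonneg (mul_nonneg (gaussCosDiff_nonneg (by linarith) ht.1.le ht.2) h0),
      rpow_add ht.1, ← mul_assoc]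
    refine mul_le_mul_of_nonneg_right ?_ h0
    exact_mod_cast gaussCosDiff_le hs t
  · refine (integrableOn_Ioi_rpow_of_lt hq' hpi).mono' hmeas.aestronglyMeasurable
      ((ae_restrict_iff' measurableSet_Ioi).2 (Eventually.of_forall fun t ht => ?_))
    have h0 : 0 ≤ t ^ q := rpow_nonneg (hpi.trans ht).le _
    rw [norm_mul, norm_of_nonneg h0]
    exact mul_le_of_le_one_left h0 (abs_gaussCosDiff_le_one (by linarith) t)

theorem integrableOn_gaussCosDiff_mul_inv_cube {s : ℝ} (hs : 1 ≤ s) :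
    IntegrableOn (fun t => gaussCosDiff s t * (t ^ 3)⁻¹) (Ioi 0) := by
  refine (integrableOn_gaussCosDiff_mul_rpow (q := -3) hs (by norm_num) (by norm_num)).congr_fun
    (fun t ht => ?_) measurableSet_Ioi
  have ht : 0 < t := ht
  simp only []
  rw [rpow_neg ht.le]
  norm_cast

theorem integrableOn_cos_rpow_mul_inv_cube {s x : ℝ} (hs : 0 ≤ s) (hx : 0 < x) :
    IntegrableOn (fun t => |cos t| ^ s * (t ^ 3)⁻¹) (Ioi x) := by
  refine (integrableOn_Ioi_inv_cube hx).mono' ?_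
    ((ae_restrict_iff' measurableSet_Ioi).2 (Eventually.of_forall fun t ht => ?_))
  · have h := ((continuous_rpow_const (q := s) hs).comp continuous_cos.abs).measurable
    exact (h.mul (by fun_prop)).aestronglyMeasurable
  · have : 0 < t := hx.trans ht
    rw [norm_of_nonneg (by positivity)]
    exact mul_le_of_le_one_left (by positivity) (abs_cos_rpow_le_one hs t)

/-- This is the limit a → 0 of the previous estimate. The Gaussian and cosine integrals from a
diverge separately, so they are first merged into `gaussCosDiff`. -/
theorem excessBound_one_le {s : ℝ} (hs : 1 ≤ s) :
    excessBound s 1 ≤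
      (∫ t in Ioc 0 (π / 2), gaussCosDiff s t * (t ^ 3)⁻¹) + gaussTail s (π / 2) := by
  have hs0 : 0 < s := by linarith
  have hpi : (0 : ℝ) < π / 2 := by positivity
  have hint := (integrableOn_gaussCosDiff_mul_inv_cube hs).mono_set
    (Ioc_subset_Ioi_self : Ioc 0 (π / 2) ⊆ Ioi 0)
  have hlim : Tendsto (fun a => excessBound s (cos a)) (𝓝[>] 0) (𝓝 (excessBound s 1)) := by
    have h := ((continuous_excessBound hs0.le).comp continuous_cos).tendsto 0
    simp only [Function.comp, cos_zero] at h
    exact h.mono_left nhdsWithin_le_nhds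
  refine le_of_tendsto hlim ?_
  filter_upwards [Ioo_mem_nhdsGT hpi] with a ha
  have h1 := integral_cos_rpow_add_excessBound_le hs0 ha.1 ha.2
  have hf := integrableOn_Ioi_gaussian_mul_inv_cube hs0.le ha.1
  have hg := integrableOn_cos_rpow_mul_inv_cube hs0.le ha.1
  have h2 : gaussTail s a = (∫ t in a..(π / 2), exp (-s * t ^ 2 / 2) * (t ^ 3)⁻¹) +
      gaussTail s (π / 2) := by
    unfold gaussTail
    rw [intervalIntegral.integral_interval_add_Ioi hf (hf.mono_set (Ioi_subset_Ioi ha.2.le))]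
  have h3 : ∫ t in Ioc a (π / 2), gaussCosDiff s t * (t ^ 3)⁻¹ =
      (∫ t in a..(π / 2), exp (-s * t ^ 2 / 2) * (t ^ 3)⁻¹) -
        ∫ t in a..(π / 2), cos t ^ s * (t ^ 3)⁻¹ := by
    rw [intervalIntegral.integral_of_le ha.2.le, intervalIntegral.integral_of_le ha.2.le,
      setIntegral_congr_fun (g := fun t => |cos t| ^ s * (t ^ 3)⁻¹)
        (f := fun t => cos t ^ s * (t ^ 3)⁻¹) measurableSet_Ioc,
      ← integral_sub (hf.mono_set Ioc_subset_Ioi_self) (hg.mono_set Ioc_subset_Ioi_self)]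
    · simp only [gaussCosDiff, sub_mul]
    · intro t ht
      have : 0 ≤ cos t := cos_nonneg_of_mem_Icc ⟨by linarith [ha.1, ht.1], ht.2⟩
      simp only [abs_of_nonneg this]
  -- The integrand is nonnegative on (0, a], so only `excessBound s (cos a)` has to pass to the
  -- limit.
  have h4 : ∫ t in Ioc a (π / 2), gaussCosDiff s t * (t ^ 3)⁻¹ ≤
      ∫ t in Ioc 0 (π / 2), gaussCosDiff s t * (t ^ 3)⁻¹ := by
    refine setIntegral_mono_set hint ?_ (Ioc_subset_Ioc_left ha.1.le).eventuallyLE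
    refine (ae_restrict_iff' measurableSet_Ioc).2 (Eventually.of_forall fun t ht => ?_)
    have := ht.1
    exact mul_nonneg (gaussCosDiff_nonneg hs0.le ht.1.le ht.2) (by positivity)
  linarith

/-- The Gaussian and the cosine cross exactly once in `[π/2, π]`. -/
theorem exists_crossing : ∃ c, π / 2 ≤ c ∧ c ≤ π ∧
    (∀ t, 0 ≤ t → t ≤ c → |cos t| ≤ exp (-t ^ 2 / 2)) ∧
    (∀ t, c ≤ t → t ≤ π → exp (-t ^ 2 / 2) ≤ |cos t|) := by
  have hpi := pi_pos
  -- ψ is the ratio of |cos| to the Gaussian on [π/2, π]; it increases from 0 to a value above 1.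
  let ψ : ℝ → ℝ := fun t => -cos t * exp (t ^ 2 / 2)
  have hψ : Continuous ψ := by fun_prop
  have hmono : ∀ x y, π / 2 ≤ x → x ≤ y → y ≤ π → ψ x ≤ ψ y := by
    intro x y hx hxy hy
    refine le_of_hasDerivAt_nonneg (f' := fun t => (sin t - t * cos t) * exp (t ^ 2 / 2)) hxy
      (fun t _ => ?_) (fun t ht => ?_)
    · refine ((hasDerivAt_cos t).neg.mul ((hasDerivAt_pow 2 t).div_const 2).exp).congr_deriv ?_
      push_cast
      simp only [Pi.neg_apply]
      ring
    · have h0 : 0 ≤ t := by linarith [ht.1]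
      have h1 : 0 ≤ sin t := sin_nonneg_of_nonneg_of_le_pi h0 (ht.2.trans hy)
      have h2 : cos t ≤ 0 := cos_nonpos_of_pi_div_two_le_of_le (by linarith [ht.1])
        (by linarith [ht.2])
      have : t * cos t ≤ 0 := mul_nonpos_of_nonneg_of_nonpos h0 h2
      exact mul_nonneg (by linarith) (exp_pos _).le
  have habs : ∀ t, π / 2 ≤ t → t ≤ π → |cos t| = ψ t * exp (-t ^ 2 / 2) := by
    intro t h0 h1
    rw [abs_of_nonpos (cos_nonpos_of_pi_div_two_le_of_le h0 (by linarith))]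
    simp only [ψ]
    rw [mul_assoc, ← exp_add]
    ring_nf
    simp
  obtain ⟨c, hc, hψc⟩ := intermediate_value_Icc (by linarith : π / 2 ≤ π) hψ.continuousOn
    (show (1 : ℝ) ∈ Icc (ψ (π / 2)) (ψ π) by
      constructor
      · simp [ψ]
      · simp only [ψ, cos_pi, neg_neg, one_mul]
        exact one_le_exp (by positivity))
  refine ⟨c, hc.1, hc.2, fun t h0 h1 => ?_, fun t h0 h1 => ?_⟩
  · rcases le_total t (π / 2) with h | h
    · exact abs_cos_le_exp h0 h
    · rw [habs t h (h1.trans hc.2)]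
      exact mul_le_of_le_one_left (exp_pos _).le ((hmono t c h h1 hc.2).trans_eq hψc)
  · rw [habs t (hc.1.trans h0) h1]
    exact le_mul_of_one_le_left (exp_pos _).le (hψc.symm.trans_le (hmono c t hc.1 h0 h1))

theorem rpow_neg_sub_one_eq {p t : ℝ} (ht : 0 < t) :
    t ^ (-p - 1) = t ^ (2 - p) * (t ^ 3)⁻¹ := by
  rw [← rpow_natCast, ← rpow_neg ht.le, ← rpow_add ht]
  congr 1
  push_cast; ring

/-- Positivity for the exponent `2` gives positivity for larger exponents. -/
theorem integral_gaussCosDiff_mul_rpow_nonneg {s p : ℝ} (hs : 1 ≤ s) (hp : 2 ≤ p) (hp' : p < 4)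
    (h : gaussTail s π ≤ ∫ t in Ioi 0, gaussCosDiff s t * (t ^ 3)⁻¹) :
    0 ≤ ∫ t in Ioi 0, gaussCosDiff s t * t ^ (-p - 1) := by
  have hs0 : 0 ≤ s := by linarith
  have hpi := pi_pos
  obtain ⟨c, hc, hcpi, hpos, hneg⟩ := exists_crossing
  have hc0 : 0 < c := by linarith
  -- Beyond π the sign of the difference is not controlled. Removing the Gaussian there leaves -|cos
  -- t|^s ≤ 0, for which replacing t^(2-p) by the larger c^(2-p) is harmless.
  let F : ℝ → ℝ := (Ioi π).indicator fun t => exp (-s * t ^ 2 / 2) * (t ^ 3)⁻¹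
  have hF : IntegrableOn F (Ioi 0) :=
    ((integrable_indicator_iff measurableSet_Ioi).2
      (integrableOn_Ioi_gaussian_mul_inv_cube hs0 pi_pos)).integrableOn
  have hFint : ∫ t in Ioi 0, F t = gaussTail s π := by
    simp only [F]
    rw [setIntegral_indicator measurableSet_Ioi, Ioi_inter_Ioi, max_eq_right pi_pos.le, gaussTail]
  have hD := integrableOn_gaussCosDiff_mul_inv_cube hs
  -- Up to π, `gaussCosDiff` and t^(2-p) - c^(2-p) both pass from nonnegative to nonpositive at c,
  -- so their product is nonnegative.
  have hle : ∫ t in Ioi 0, c ^ (2 - p) * (gaussCosDiff s t * (t ^ 3)⁻¹ - F t) ≤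
      ∫ t in Ioi 0, gaussCosDiff s t * t ^ (-p - 1) := by
    refine setIntegral_mono_on ((hD.sub hF).const_mul _)
      (integrableOn_gaussCosDiff_mul_rpow hs (by linarith) (by linarith)) measurableSet_Ioi
      fun t ht => ?_
    have ht : 0 < t := ht
    have ht3 : 0 ≤ (t ^ 3)⁻¹ := by positivity
    rw [rpow_neg_sub_one_eq ht]
    rcases le_or_gt t π with htpi | htpi
    · have hFt : F t = 0 := indicator_of_notMem (by simpa using htpi) _
      rw [hFt, sub_zero, ← mul_assoc, ← mul_assoc]
      refine mul_le_mul_of_nonneg_right ?_ ht3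
      rw [mul_comm]
      rcases le_total t c with htc | htc
      · exact mul_le_mul_of_nonneg_left
          (rpow_le_rpow_of_nonpos ht htc (by linarith))
          (gaussCosDiff_nonneg_of_le hs0 (hpos t ht.le htc))
      · exact mul_le_mul_of_nonpos_left
          (rpow_le_rpow_of_nonpos hc0 htc (by linarith))
          (gaussCosDiff_nonpos_of_le hs0 (hneg t htc htpi))
    · have hFt : F t = exp (-s * t ^ 2 / 2) * (t ^ 3)⁻¹ := indicator_of_mem (by simpa using htpi) _
      rw [hFt, ← sub_mul, ← mul_assoc, ← mul_assoc]
      refine mul_le_mul_of_nonneg_right ?_ ht3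
      have h1 : t ^ (2 - p) ≤ c ^ (2 - p) :=
        rpow_le_rpow_of_nonpos hc0 (hcpi.trans htpi.le) (by linarith)
      have h2 : 0 ≤ t ^ (2 - p) := rpow_nonneg ht.le _
      have h3 : 0 ≤ |cos t| ^ s := by positivity
      have h4 := exp_pos (-s * t ^ 2 / 2)
      unfold gaussCosDiff
      nlinarith [mul_nonneg h2 h4.le, mul_le_mul_of_nonneg_left h1 h3]
  refine le_trans ?_ hle
  rw [integral_const_mul, integral_sub hD hF, hFint]
  exact mul_nonneg (rpow_nonneg hc0.le _) (by linarith)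

/-- The tail `∫_{π/2}^∞ |cos t| ^ s t⁻³ dt`. -/
noncomputable def cosTail (s : ℝ) : ℝ := ∫ t in Ioi (π / 2), |cos t| ^ s * (t ^ 3)⁻¹

theorem excessBound_sub_cosTail_le {s : ℝ} (hs : 1 ≤ s) :
    excessBound s 1 - cosTail s ≤ ∫ t in Ioi 0, gaussCosDiff s t * (t ^ 3)⁻¹ := by
  have hpi : (0 : ℝ) < π / 2 := by positivity
  have hD := integrableOn_gaussCosDiff_mul_inv_cube hs
  have h1 : ∫ t in Ioi (π / 2), gaussCosDiff s t * (t ^ 3)⁻¹ =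
      gaussTail s (π / 2) - cosTail s := by
    rw [gaussTail, cosTail,
      ← integral_sub (integrableOn_Ioi_gaussian_mul_inv_cube (by linarith) hpi)
        (integrableOn_cos_rpow_mul_inv_cube (by linarith) hpi)]
    simp only [gaussCosDiff, sub_mul]
  rw [← Ioc_union_Ioi_eq_Ioi hpi.le, setIntegral_union Ioc_disjoint_Ioi_same measurableSet_Ioi
    (hD.mono_set Ioc_subset_Ioi_self) (hD.mono_set (Ioi_subset_Ioi hpi.le)), h1]
  linarith [excessBound_one_le hs]

end Difference

/-! ### Numerical bounds for the cosine tail, and the integral inequality. -/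

section CosineTail
open Real Set Filter Topology

theorem integral_cos_mul_even_polynomial (a b c d : ℝ) :
    ∫ x in (0 : ℝ)..(π / 2), cos x * (a + b * x ^ 2 + c * x ^ 4 + d * x ^ 6) =
      a + b * ((π / 2) ^ 2 - 2) + c * ((π / 2) ^ 4 - 12 * (π / 2) ^ 2 + 24) +
        d * ((π / 2) ^ 6 - 30 * (π / 2) ^ 4 + 360 * (π / 2) ^ 2 - 720) := by
  rw [intervalIntegral.integral_eq_sub_of_hasDerivAt
    (f := fun x => sin x * (a + b * (x ^ 2 - 2) + c * (x ^ 4 - 12 * x ^ 2 + 24) +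
        d * (x ^ 6 - 30 * x ^ 4 + 360 * x ^ 2 - 720)) +
      cos x * (b * (2 * x) + c * (4 * x ^ 3 - 24 * x) + d * (6 * x ^ 5 - 120 * x ^ 3 + 720 * x)))]
  · simp
  · intro x _
    have e2 := hasDerivAt_pow 2 x
    have e4 := hasDerivAt_pow 4 x
    have e6 := hasDerivAt_pow 6 x
    have e3 := hasDerivAt_pow 3 x
    have e5 := hasDerivAt_pow 5 x
    have e1 := hasDerivAt_id x
    refine (((hasDerivAt_sin x).mul ((((e2.sub_const 2).const_mul b).const_add a).add
      (((e4.sub (e2.const_mul 12)).add_const 24).const_mul c) |>.add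
      ((((e6.sub (e4.const_mul 30)).add (e2.const_mul 360)).sub_const 720).const_mul d))).add
      ((hasDerivAt_cos x).mul ((((e1.const_mul 2).const_mul b).add
        (((e3.const_mul 4).sub (e1.const_mul 24)).const_mul c)).add
        ((((e5.const_mul 6).sub (e3.const_mul 120)).add (e1.const_mul 720)).const_mul d)))
      ).congr_deriv ?_
    simp only [Pi.add_apply, Pi.sub_apply, id]
    push_cast
    ring
  · exact Continuous.intervalIntegrable (by fun_prop) _ _

theorem integral_cos_sq_mul_even_polynomial (a b c d : ℝ) :
    ∫ x in (0 : ℝ)..(π / 2), cos x ^ 2 * (a + b * x ^ 2 + c * x ^ 4 + d * x ^ 6) =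
      (a * (π / 2) + b * (π / 2) ^ 3 / 3 + c * (π / 2) ^ 5 / 5 + d * (π / 2) ^ 7 / 7) / 2 -
        (b * (π / 2) / 2 + c * ((π / 2) ^ 3 - 3 / 2 * (π / 2)) +
          d * (3 / 2 * (π / 2) ^ 5 - 15 / 2 * (π / 2) ^ 3 + 45 / 4 * (π / 2))) / 2 := by
  have hcos : ∀ x, cos x ^ 2 * (a + b * x ^ 2 + c * x ^ 4 + d * x ^ 6) =
      (1 + cos (2 * x)) / 2 * (a + b * x ^ 2 + c * x ^ 4 + d * x ^ 6) := by
    intro x; rw [cos_sq]; ring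
  simp only [hcos]
  rw [intervalIntegral.integral_eq_sub_of_hasDerivAt
    (f := fun x => (a * x + b / 3 * x ^ 3 + c / 5 * x ^ 5 + d / 7 * x ^ 7) / 2 +
      (sin (2 * x) * (a / 2 + b * (x ^ 2 / 2 - 1 / 4) + c * (x ^ 4 / 2 - 3 / 2 * x ^ 2 + 3 / 4) +
        d * (x ^ 6 / 2 - 15 / 4 * x ^ 4 + 45 / 4 * x ^ 2 - 45 / 8)) +
      cos (2 * x) * (b * (x / 2) + c * (x ^ 3 - 3 / 2 * x) +
        d * (3 / 2 * x ^ 5 - 15 / 2 * x ^ 3 + 45 / 4 * x))) / 2)]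
  · have h1 : 2 * (π / 2) = π := by ring
    simp only [h1, sin_pi, cos_pi, mul_zero, sin_zero]
    ring
  · intro x _
    have e2 := hasDerivAt_pow 2 x
    have e4 := hasDerivAt_pow 4 x
    have e6 := hasDerivAt_pow 6 x
    have e3 := hasDerivAt_pow 3 x
    have e5 := hasDerivAt_pow 5 x
    have e7 := hasDerivAt_pow 7 x
    have e1 := hasDerivAt_id x
    have es := (e1.const_mul 2).sin
    have ec := (e1.const_mul 2).cos
    refine HasDerivAt.congr_deriv ((((((e1.const_mul a).add (e3.const_mul (b / 3))).add
      (e5.const_mul (c / 5))).add (e7.const_mul (d / 7))).div_const 2).add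
      (((es.mul (((((e2.div_const 2).sub_const (1 / 4)).const_mul b).const_add (a / 2)).add
        ((((e4.div_const 2).sub (e2.const_mul (3 / 2))).add_const (3 / 4)).const_mul c) |>.add
        (((((e6.div_const 2).sub (e4.const_mul (15 / 4))).add
          (e2.const_mul (45 / 4))).sub_const (45 / 8)).const_mul d))).add
      (ec.mul ((((e1.div_const 2).const_mul b).add
        ((e3.sub (e1.const_mul (3 / 2))).const_mul c)).add
        ((((e5.const_mul (3 / 2)).sub (e3.const_mul (15 / 2))).add
          (e1.const_mul (45 / 4))).const_mul d)))).div_const 2)) ?_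
    simp only [Pi.add_apply, Pi.sub_apply, id]
    push_cast
    ring
  · exact Continuous.intervalIntegrable (by fun_prop) _ _

theorem abs_cos_nat_mul_pi_add (k : ℕ) (x : ℝ) : |cos (k * π + x)| = |cos x| := by
  rw [add_comm, cos_add_nat_mul_pi, abs_mul, abs_pow, abs_neg, abs_one, one_pow, one_mul]

theorem abs_cos_nat_mul_pi_sub (k : ℕ) (x : ℝ) : |cos (k * π - x)| = |cos x| := by
  rw [sub_eq_add_neg, abs_cos_nat_mul_pi_add, cos_neg]

/-- The contribution of one half-period around `k π`, folded at `k π`. -/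
theorem integral_hump_eq (m : ℕ) {k : ℕ} (hk : 1 ≤ k) :
    ∫ t in (k * π - π / 2)..(k * π + π / 2), |cos t| ^ m * (t ^ 3)⁻¹ =
      ∫ x in (0 : ℝ)..(π / 2), |cos x| ^ m * (((k * π + x) ^ 3)⁻¹ + ((k * π - x) ^ 3)⁻¹) := by
  have hpi := pi_pos
  have hk1 : (1 : ℝ) ≤ k := by exact_mod_cast hk
  have hkpi : π ≤ k * π := le_mul_of_one_le_left hpi.le hk1
  have hint : ∀ a b : ℝ, 0 < a → 0 < b →
      IntervalIntegrable (fun t => |cos t| ^ m * (t ^ 3)⁻¹) volume a b := by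
    intro a b ha hb
    refine ContinuousOn.intervalIntegrable (ContinuousOn.mul (by fun_prop)
      (ContinuousOn.inv₀ (by fun_prop) fun t ht => ?_))
    have : 0 < t := (lt_min ha hb).trans_le ht.1
    positivity
  rw [← intervalIntegral.integral_add_adjacent_intervals
    (hint (k * π - π / 2) (k * π) (by linarith) (by linarith))
    (hint (k * π) (k * π + π / 2) (by linarith) (by linarith))]
  have h1 := intervalIntegral.integral_comp_add_left (a := 0) (b := π / 2)
    (fun t => |cos t| ^ m * (t ^ 3)⁻¹) (k * π)
  have h2 := intervalIntegral.integral_comp_sub_left (a := 0) (b := π / 2)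
    (fun t => |cos t| ^ m * (t ^ 3)⁻¹) (k * π)
  rw [add_zero] at h1
  rw [sub_zero] at h2
  rw [← h1, ← h2, ← intervalIntegral.integral_add]
  · refine intervalIntegral.integral_congr fun x _ => ?_
    simp only [abs_cos_nat_mul_pi_add, abs_cos_nat_mul_pi_sub]
    ring
  · refine ContinuousOn.intervalIntegrable (ContinuousOn.mul (by fun_prop)
      (ContinuousOn.inv₀ (by fun_prop) fun t ht => ?_))
    rw [uIcc_of_le (by positivity)] at ht
    have : 0 < k * π - t := by linarith [ht.2]
    positivity
  · refine ContinuousOn.intervalIntegrable (ContinuousOn.mul (by fun_prop)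
      (ContinuousOn.inv₀ (by fun_prop) fun t ht => ?_))
    rw [uIcc_of_le (by positivity)] at ht
    have : 0 < k * π + t := by linarith [ht.1]
    positivity

theorem integral_hump_le {m k : ℕ} (hk : 1 ≤ k) {P : ℝ → ℝ} (hP : Continuous P)
    (h : ∀ x, 0 ≤ x → x ≤ π / 2 → ((k * π + x) ^ 3)⁻¹ + ((k * π - x) ^ 3)⁻¹ ≤ P x) :
    ∫ t in (k * π - π / 2)..(k * π + π / 2), |cos t| ^ m * (t ^ 3)⁻¹ ≤
      ∫ x in (0 : ℝ)..(π / 2), cos x ^ m * P x := by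
  have hpi := pi_pos
  have hk1 : (1 : ℝ) ≤ k := by exact_mod_cast hk
  have hkpi : π ≤ k * π := le_mul_of_one_le_left hpi.le hk1
  rw [integral_hump_eq m hk]
  refine intervalIntegral.integral_mono_on (by positivity) ?_
    (Continuous.intervalIntegrable (by fun_prop) _ _) fun x hx => ?_
  · refine ContinuousOn.intervalIntegrable (ContinuousOn.mul (by fun_prop) (ContinuousOn.add
      (ContinuousOn.inv₀ (by fun_prop) fun t ht => ?_)
      (ContinuousOn.inv₀ (by fun_prop) fun t ht => ?_)))
    all_goals rw [uIcc_of_le (by positivity)] at ht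
    · have : 0 < k * π + t := by linarith [ht.1]
      positivity
    · have : 0 < k * π - t := by linarith [ht.2]
      positivity
  · have hc : 0 ≤ cos x := cos_nonneg_of_mem_Icc ⟨by linarith [hx.1], hx.2⟩
    rw [abs_of_nonneg hc]
    exact mul_le_mul_of_nonneg_left (h x hx.1 hx.2) (by positivity)

theorem inv_cube_add_inv_cube_eq {A x : ℝ} (hx : 0 ≤ x) (hA : x < A) :
    ((A + x) ^ 3)⁻¹ + ((A - x) ^ 3)⁻¹ =
      2 / A ^ 3 * ((1 + 3 * (x ^ 2 / A ^ 2)) / (1 - x ^ 2 / A ^ 2) ^ 3) := by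
  have h1 : 0 < A - x := sub_pos.2 hA
  have h2 : 0 < A := hx.trans_lt hA
  have h3 : 0 < A + x := by linarith
  have h4 : 1 - x ^ 2 / A ^ 2 = (A - x) * (A + x) / A ^ 2 := by
    field_simp; ring
  rw [h4]
  field_simp
  ring

/-- With z = x²/π² ≤ 1/4, (1 + 3z)/(1 - z)³ = 1 + 6z + 15z² + 28z³ + ...; raising 28 to 91/2 absorbs
all later terms. -/
theorem inv_cube_add_inv_cube_le_cubic {x : ℝ} (hx : 0 ≤ x) (hx' : x ≤ π / 2) :
    ((π + x) ^ 3)⁻¹ + ((π - x) ^ 3)⁻¹ ≤ 2 / π ^ 3 * (1 + 6 / π ^ 2 * x ^ 2 +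
      15 / π ^ 4 * x ^ 4 + 91 / 2 / π ^ 6 * x ^ 6) := by
  have hpi := pi_pos
  rw [inv_cube_add_inv_cube_eq hx (by linarith)]
  refine mul_le_mul_of_nonneg_left ?_ (by positivity)
  have hz0 : 0 ≤ x ^ 2 / π ^ 2 := by positivity
  have hz1 : x ^ 2 / π ^ 2 ≤ 1 / 4 := by
    rw [div_le_iff₀ (by positivity)]; nlinarith
  have e : 1 + 6 / π ^ 2 * x ^ 2 + 15 / π ^ 4 * x ^ 4 + 91 / 2 / π ^ 6 * x ^ 6 =
      1 + 6 * (x ^ 2 / π ^ 2) + 15 * (x ^ 2 / π ^ 2) ^ 2 + 91 / 2 * (x ^ 2 / π ^ 2) ^ 3 := by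
    field_simp
  rw [e]
  generalize x ^ 2 / π ^ 2 = z at *
  rw [div_le_iff₀ (pow_pos (by linarith) 3)]
  -- After clearing denominators and removing z³, division by 1/4 - z leaves the remainder 1/128,
  -- the slack at the extreme z = 1/4.
  have h1 : 0 ≤ (1 / 4 - z) * (2239 / 32 - 881 / 8 * z + 91 / 2 * z ^ 2) :=
    mul_nonneg (by linarith) (by nlinarith)
  have h2 : 0 ≤ z ^ 3 * ((1 / 4 - z) * (2239 / 32 - 881 / 8 * z + 91 / 2 * z ^ 2) + 1 / 128) := by
    positivity
  nlinarith

/-- Here z = x²/A² ≤ 1/16, and raising the linear coefficient 6 to 353/50 absorbs the rest. Using 4z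
≤ x²/π² then makes the bracket independent of A, so all later half-periods share one integral. -/
theorem inv_cube_add_inv_cube_le_linear {A x : ℝ} (hx : 0 ≤ x) (hx' : x ≤ π / 2) (hA : 2 * π ≤ A) :
    ((A + x) ^ 3)⁻¹ + ((A - x) ^ 3)⁻¹ ≤ 2 / A ^ 3 * (1 + 353 / 200 / π ^ 2 * x ^ 2) := by
  have hpi := pi_pos
  have hA0 : 0 < A := by linarith
  rw [inv_cube_add_inv_cube_eq hx (by linarith)]
  refine mul_le_mul_of_nonneg_left ?_ (by positivity)
  have hz0 : 0 ≤ x ^ 2 / A ^ 2 := by positivity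
  have hz1 : x ^ 2 / A ^ 2 ≤ 1 / 16 := by
    rw [div_le_iff₀ (by positivity)]; nlinarith
  have hz2 : 4 * (x ^ 2 / A ^ 2) ≤ x ^ 2 / π ^ 2 := by
    have : x ^ 2 / π ^ 2 = 4 * (x ^ 2 / (2 * π) ^ 2) := by field_simp; norm_num
    rw [this]
    gcongr
  have e : 1 + 353 / 200 / π ^ 2 * x ^ 2 = 1 + 353 / 200 * (x ^ 2 / π ^ 2) := by
    field_simp
  rw [e]
  refine le_trans (b := 1 + 353 / 50 * (x ^ 2 / A ^ 2)) ?_ (by linarith)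
  generalize x ^ 2 / A ^ 2 = z at *
  rw [div_le_iff₀ (pow_pos (by linarith) 3)]
  have h1 : 0 ≤ (1 / 16 - z) * (216913/12800 - 15791/800 * z + 353 / 50 * z ^ 2) :=
    mul_nonneg (by linarith) (by nlinarith)
  have h2 : 0 ≤ z * ((1 / 16 - z) * (216913/12800 - 15791/800 * z + 353 / 50 * z ^ 2) + 7/8192) := by
    positivity
  nlinarith


/-- Summation over half-periods: the first one is estimated separately. -/
theorem integral_Ioi_abs_cos_pow_le {m : ℕ} {H₁ H₂ : ℝ}
    (h₁ : ∫ t in (π - π / 2)..(π + π / 2), |cos t| ^ m * (t ^ 3)⁻¹ ≤ H₁)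
    (h₂ : ∀ k : ℕ, 2 ≤ k →
      ∫ t in (k * π - π / 2)..(k * π + π / 2), |cos t| ^ m * (t ^ 3)⁻¹ ≤ H₂ / k ^ 3)
    (hH₂ : 0 ≤ H₂) :
    ∫ t in Ioi (π / 2), |cos t| ^ m * (t ^ 3)⁻¹ ≤ H₁ + H₂ * (11 / 54) := by
  have hpi := pi_pos
  have hint : ∀ a b : ℝ, 0 < a → 0 < b →
      IntervalIntegrable (fun t => |cos t| ^ m * (t ^ 3)⁻¹) volume a b := by
    intro a b ha hb
    refine ContinuousOn.intervalIntegrable (ContinuousOn.mul (by fun_prop)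
      (ContinuousOn.inv₀ (by fun_prop) fun t ht => ?_))
    have : 0 < t := (lt_min ha hb).trans_le ht.1
    positivity
  have hstep : ∀ n : ℕ, ∫ t in (π / 2)..((n + 1 : ℕ) * π + π / 2), |cos t| ^ m * (t ^ 3)⁻¹ =
      (∫ t in (π / 2)..(n * π + π / 2), |cos t| ^ m * (t ^ 3)⁻¹) +
        ∫ t in ((n + 1 : ℕ) * π - π / 2)..((n + 1 : ℕ) * π + π / 2),
          |cos t| ^ m * (t ^ 3)⁻¹ := by
    intro n
    have e : ((n + 1 : ℕ) * π - π / 2 : ℝ) = n * π + π / 2 := by push_cast; ring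
    rw [e, intervalIntegral.integral_add_adjacent_intervals] <;>
      exact hint _ _ (by positivity) (by positivity)
  -- 11/54 = 1/8 + 1/27 + 1/24: the terms k = 2, 3 exactly, and for k ≥ 4 the telescoping bound 1/k³
  -- ≤ 1/((k-1)k(k+1)), with sum 1/24.
  have hbound : ∀ n : ℕ, 3 ≤ n →
      ∫ t in (π / 2)..(n * π + π / 2), |cos t| ^ m * (t ^ 3)⁻¹ ≤
        H₁ + H₂ * (11 / 54 - 1 / (2 * n * (n + 1))) := by
    intro n hn
    induction n, hn using Nat.le_induction with
    | base =>
      have e1 := hstep 0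
      have e2 := hstep 1
      have e3 := hstep 2
      have b2 := h₂ 2 le_rfl
      have b3 := h₂ 3 (by norm_num)
      norm_num at e1 e2 e3 b2 b3 ⊢
      linarith
    | succ n hn ih =>
      have hn3 : (3 : ℝ) ≤ n := by exact_mod_cast hn
      have b := h₂ (n + 1) (by omega)
      rw [hstep n]
      have hk : 1 / ((n : ℝ) + 1) ^ 3 ≤
          1 / (2 * n * (n + 1)) - 1 / (2 * (n + 1) * (n + 1 + 1)) := by
        have e : 1 / (2 * (n : ℝ) * (n + 1)) - 1 / (2 * (n + 1) * (n + 1 + 1)) =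
            1 / (n * (n + 1) * (n + 2)) := by
          field_simp; ring
        rw [e]
        refine one_div_le_one_div_of_le (by positivity) ?_
        nlinarith
      have hk2 := mul_le_mul_of_nonneg_left hk hH₂
      simp only [Nat.cast_add, Nat.cast_one] at b ⊢
      have e : H₂ / ((n : ℝ) + 1) ^ 3 = H₂ * (1 / ((n : ℝ) + 1) ^ 3) := div_eq_mul_one_div _ _
      rw [e] at b
      linarith
  have hI : IntegrableOn (fun t => |cos t| ^ m * (t ^ 3)⁻¹) (Ioi (π / 2)) := by
    have := integrableOn_cos_rpow_mul_inv_cube (s := m) (x := π / 2) (by positivity) (by positivity)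
    simpa only [rpow_natCast] using this
  have hlim : Tendsto (fun n : ℕ => (n * π + π / 2 : ℝ)) atTop atTop :=
    tendsto_atTop_add_const_right _ _ (tendsto_natCast_atTop_atTop.atTop_mul_const hpi)
  refine le_of_tendsto (intervalIntegral_tendsto_integral_Ioi (π / 2) hI hlim) ?_
  filter_upwards [eventually_ge_atTop 3] with n hn
  refine (hbound n hn).trans ?_
  have : 0 ≤ H₂ * (1 / (2 * (n : ℝ) * (n + 1))) := by positivity
  linarith

theorem integral_Ioi_abs_cos_pow_le_polynomial (m : ℕ) :
    ∫ t in Ioi (π / 2), |cos t| ^ m * (t ^ 3)⁻¹ ≤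
      2 / π ^ 3 * (∫ x in (0 : ℝ)..(π / 2), cos x ^ m * (1 + 6 / π ^ 2 * x ^ 2 +
        15 / π ^ 4 * x ^ 4 + 91 / 2 / π ^ 6 * x ^ 6)) +
      2 / π ^ 3 * (∫ x in (0 : ℝ)..(π / 2), cos x ^ m * (1 + 353 / 200 / π ^ 2 * x ^ 2 +
        0 * x ^ 4 + 0 * x ^ 6)) * (11 / 54) := by
  have hpi := pi_pos
  refine integral_Ioi_abs_cos_pow_le ?_ (fun k hk => ?_) ?_
  · have h := integral_hump_le (m := m) (k := 1) le_rfl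
      (P := fun x => 2 / π ^ 3 * (1 + 6 / π ^ 2 * x ^ 2 + 15 / π ^ 4 * x ^ 4 +
        91 / 2 / π ^ 6 * x ^ 6)) (by fun_prop) (fun x h0 h1 => by
          simpa only [Nat.cast_one, one_mul] using inv_cube_add_inv_cube_le_cubic h0 h1)
    rw [Nat.cast_one, one_mul] at h
    refine h.trans_eq ?_
    rw [← intervalIntegral.integral_const_mul]
    congr 1; ext x; ring
  · have hk2 : (2 : ℝ) ≤ k := by exact_mod_cast hk
    have h := integral_hump_le (m := m) (k := k) (by omega)
      (P := fun x => 2 / (k * π) ^ 3 * (1 + 353 / 200 / π ^ 2 * x ^ 2)) (by fun_prop)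
      (fun x h0 h1 => inv_cube_add_inv_cube_le_linear h0 h1
        (mul_le_mul_of_nonneg_right hk2 hpi.le))
    refine h.trans_eq ?_
    rw [← intervalIntegral.integral_const_mul, ← intervalIntegral.integral_div]
    congr 1; ext x
    field_simp
    ring
  · refine mul_nonneg (by positivity) (intervalIntegral.integral_nonneg (by positivity)
      fun x hx => ?_)
    have hc : 0 ≤ cos x := cos_nonneg_of_mem_Icc ⟨by linarith [hx.1], hx.2⟩
    have : 0 ≤ 1 + 353 / 200 / π ^ 2 * x ^ 2 + 0 * x ^ 4 + 0 * x ^ 6 := by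
      rw [zero_mul, zero_mul]; positivity
    positivity

theorem inv_pi_bounds : 0.31830988 < π⁻¹ ∧ π⁻¹ < 0.31830989 := by
  have h1 := pi_gt_d20
  have h2 := pi_lt_d20
  constructor
  · rw [lt_inv_comm₀ (by norm_num) pi_pos]
    refine h2.trans ?_
    norm_num
  · rw [inv_lt_comm₀ pi_pos (by norm_num)]
    refine lt_trans ?_ h1
    norm_num

theorem cosTail_one_le : cosTail 1 ≤ 0.1039 := by
  have h := integral_Ioi_abs_cos_pow_le_polynomial 1
  simp only [pow_one] at h
  rw [integral_cos_mul_even_polynomial, integral_cos_mul_even_polynomial] at h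
  unfold cosTail
  simp only [rpow_one]
  refine h.trans ?_
  obtain ⟨l1, u1⟩ := inv_pi_bounds
  have hp : π ≠ 0 := pi_ne_zero
  have e : ∀ u : ℝ, u = π⁻¹ → 2 / π ^ 3 * (1 + 6 / π ^ 2 * ((π / 2) ^ 2 - 2) +
      15 / π ^ 4 * ((π / 2) ^ 4 - 12 * (π / 2) ^ 2 + 24) +
      91 / 2 / π ^ 6 * ((π / 2) ^ 6 - 30 * (π / 2) ^ 4 + 360 * (π / 2) ^ 2 - 720)) +
    2 / π ^ 3 * (1 + 353 / 200 / π ^ 2 * ((π / 2) ^ 2 - 2) +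
      0 * ((π / 2) ^ 4 - 12 * (π / 2) ^ 2 + 24) +
      0 * ((π / 2) ^ 6 - 30 * (π / 2) ^ 4 + 360 * (π / 2) ^ 2 - 720)) * (11 / 54) =
    2 * u ^ 3 * (1 + 6 * (1 / 4 - 2 * u ^ 2) + 15 * (1 / 16 - 3 * u ^ 2 + 24 * u ^ 4) +
      91 / 2 * (1 / 64 - 15 / 8 * u ^ 2 + 90 * u ^ 4 - 720 * u ^ 6) +
      11 / 54 * (1 + 353 / 200 * (1 / 4 - 2 * u ^ 2))) := by
    rintro u rfl
    field_simp
    ring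
  rw [e _ rfl]
  generalize π⁻¹ = u at *
  have l0 : (0 : ℝ) ≤ 0.31830988 := by norm_num
  have u0 : 0 ≤ u := l0.trans l1.le
  have p := fun n : ℕ => pow_le_pow_left₀ l0 l1.le n
  have q := fun n : ℕ => pow_le_pow_left₀ u0 u1.le n
  have p2 := p 2
  have p6 := p 6
  have q3 := q 3
  have q4 := q 4
  -- The coefficients of u² and u⁶ are negative and that of u⁴ is positive, which decides the side
  -- of each bound on u = 1/π.
  have hb : 1 + 6 * (1 / 4 - 2 * u ^ 2) + 15 * (1 / 16 - 3 * u ^ 2 + 24 * u ^ 4) +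
      91 / 2 * (1 / 64 - 15 / 8 * u ^ 2 + 90 * u ^ 4 - 720 * u ^ 6) +
      11 / 54 * (1 + 353 / 200 * (1 / 4 - 2 * u ^ 2)) ≤ 1.6097 := by
    norm_num at p2 p6 q4 ⊢
    linarith
  calc _ ≤ 2 * u ^ 3 * 1.6097 := mul_le_mul_of_nonneg_left hb (by positivity)
    _ ≤ _ := by norm_num at q3 ⊢; linarith

theorem cosTail_two_le : cosTail 2 ≤ 0.0742 := by
  have h := integral_Ioi_abs_cos_pow_le_polynomial 2
  rw [integral_cos_sq_mul_even_polynomial, integral_cos_sq_mul_even_polynomial] at h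
  unfold cosTail
  simp only [rpow_ofNat]
  refine h.trans ?_
  obtain ⟨l1, u1⟩ := inv_pi_bounds
  have hp : π ≠ 0 := pi_ne_zero
  have e : ∀ u : ℝ, u = π⁻¹ → 2 / π ^ 3 *
        ((1 * (π / 2) + 6 / π ^ 2 * (π / 2) ^ 3 / 3 + 15 / π ^ 4 * (π / 2) ^ 5 / 5 +
          91 / 2 / π ^ 6 * (π / 2) ^ 7 / 7) / 2 -
          (6 / π ^ 2 * (π / 2) / 2 + 15 / π ^ 4 * ((π / 2) ^ 3 - 3 / 2 * (π / 2)) +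
              91 / 2 / π ^ 6 * (3 / 2 * (π / 2) ^ 5 - 15 / 2 * (π / 2) ^ 3 + 45 / 4 * (π / 2))) /
            2) +
      2 / π ^ 3 *
          ((1 * (π / 2) + 353 / 200 / π ^ 2 * (π / 2) ^ 3 / 3 + 0 * (π / 2) ^ 5 / 5 +
            0 * (π / 2) ^ 7 / 7) / 2 -
            (353 / 200 / π ^ 2 * (π / 2) / 2 + 0 * ((π / 2) ^ 3 - 3 / 2 * (π / 2)) +
                0 * (3 / 2 * (π / 2) ^ 5 - 15 / 2 * (π / 2) ^ 3 + 45 / 4 * (π / 2))) / 2) *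
        (11 / 54) =
    u ^ 2 * ((1 + 1 / 2 + 3 / 16 + 13 / 128) - (3 * u ^ 2 + 15 * (u ^ 2 / 4 - 3 / 2 * u ^ 4) +
      91 / 2 * (3 / 32 * u ^ 2 - 15 / 8 * u ^ 4 + 45 / 4 * u ^ 6)) +
      11 / 54 * (1 + 353 / 2400 - 353 / 400 * u ^ 2)) / 2 := by
    rintro u rfl
    field_simp
    ring
  rw [e _ rfl]
  generalize π⁻¹ = u at *
  have l0 : (0 : ℝ) ≤ 0.31830988 := by norm_num
  have u0 : 0 ≤ u := l0.trans l1.le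
  have p := fun n : ℕ => pow_le_pow_left₀ l0 l1.le n
  have q := fun n : ℕ => pow_le_pow_left₀ u0 u1.le n
  have p2 := p 2
  have p6 := p 6
  have q2 := q 2
  have q4 := q 4
  have hb : (1 + 1 / 2 + 3 / 16 + 13 / 128) - (3 * u ^ 2 + 15 * (u ^ 2 / 4 - 3 / 2 * u ^ 4) +
      91 / 2 * (3 / 32 * u ^ 2 - 15 / 8 * u ^ 4 + 45 / 4 * u ^ 6)) +
      11 / 54 * (1 + 353 / 2400 - 353 / 400 * u ^ 2) ≤ 1.463 := by
    norm_num at p2 p6 q4 ⊢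
    linarith
  calc _ ≤ u ^ 2 * 1.463 / 2 := by gcongr
    _ ≤ _ := by norm_num at q2 ⊢; linarith

theorem cosTail_le_of_two_le {s : ℝ} (hs : 2 ≤ s) : cosTail s ≤ cosTail 2 := by
  have hpi : (0 : ℝ) < π / 2 := by positivity
  refine setIntegral_mono_on (integrableOn_cos_rpow_mul_inv_cube (by linarith) hpi)
    (integrableOn_cos_rpow_mul_inv_cube (by norm_num) hpi) measurableSet_Ioi fun t ht => ?_
  have : 0 < t := hpi.trans ht
  exact mul_le_mul_of_nonneg_right (rpow_le_rpow_of_exponent_ge_of_imp (abs_nonneg _)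
    (abs_cos_le_one t) hs (fun _ h => by linarith)) (by positivity)

/-- |cos t|^s is convex in s, and s = (2 - s)·1 + (s - 1)·2. -/
theorem cosTail_le_interpolation {s : ℝ} (hs : 1 ≤ s) (hs' : s ≤ 2) :
    cosTail s ≤ (2 - s) * cosTail 1 + (s - 1) * cosTail 2 := by
  have hpi : (0 : ℝ) < π / 2 := by positivity
  have i1 := integrableOn_cos_rpow_mul_inv_cube (s := 1) zero_le_one hpi
  have i2 := integrableOn_cos_rpow_mul_inv_cube (s := 2) zero_le_two hpi
  unfold cosTail
  rw [← integral_const_mul, ← integral_const_mul,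
    ← integral_add (i1.const_mul _) (i2.const_mul _)]
  refine setIntegral_mono_on (integrableOn_cos_rpow_mul_inv_cube (by linarith) hpi)
    ((i1.const_mul _).add (i2.const_mul _)) measurableSet_Ioi fun t ht => ?_
  have ht : 0 < t := hpi.trans ht
  have h := geom_mean_le_arith_mean2_weighted (sub_nonneg.2 hs') (sub_nonneg.2 hs)
    (rpow_nonneg (abs_nonneg (cos t)) 1) (rpow_nonneg (abs_nonneg (cos t)) 2) (by ring)
  rw [← rpow_mul (abs_nonneg _), ← rpow_mul (abs_nonneg _),
    ← rpow_add_of_nonneg (abs_nonneg _) (by linarith) (by linarith)] at h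
  have e : 1 * (2 - s) + 2 * (s - 1) = s := by ring
  rw [e] at h
  rw [← mul_assoc, ← mul_assoc, ← add_mul]
  exact mul_le_mul_of_nonneg_right h (by positivity)

/-- For t ≥ π the exponent st²/2 is at least (7/5)·9.85/2 > 6. -/
theorem gaussTail_pi_le {s : ℝ} (hs : 7 / 5 ≤ s) : gaussTail s π ≤ 0.00014 := by
  have hpi := pi_pos
  have hs0 : 0 ≤ s := by linarith
  have hpi2 : 9.85 ≤ π ^ 2 := by nlinarith [pi_gt_d2]
  have h1 : gaussTail s π ≤ exp (-6) * (1 / (2 * π ^ 2)) := by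
    rw [← integral_Ioi_inv_cube hpi, ← integral_const_mul]
    refine setIntegral_mono_on (integrableOn_Ioi_gaussian_mul_inv_cube hs0 hpi)
      ((integrableOn_Ioi_inv_cube hpi).const_mul _) measurableSet_Ioi fun t ht => ?_
    have ht : π < t := ht
    have ht0 : 0 < t := hpi.trans ht
    refine mul_le_mul_of_nonneg_right (exp_le_exp.2 ?_) (by positivity)
    have : π ^ 2 ≤ t ^ 2 := pow_le_pow_left₀ hpi.le ht.le 2
    nlinarith
  have h2 : exp (-6) ≤ 1 / 387 := by
    rw [exp_neg, ← one_div]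
    refine one_div_le_one_div_of_le (by norm_num) ?_
    have h := pow_le_pow_left₀ (by norm_num) exp_one_gt_d9.le 6
    rw [← exp_nat_mul] at h
    norm_num at h ⊢
    linarith
  have h3 : 1 / (2 * π ^ 2) ≤ 1 / (2 * 9.85) :=
    one_div_le_one_div_of_le (by norm_num) (by linarith)
  calc gaussTail s π ≤ exp (-6) * (1 / (2 * π ^ 2)) := h1
    _ ≤ 1 / 387 * (1 / (2 * 9.85)) := by gcongr
    _ ≤ _ := by norm_num

theorem excessBound_one_eq {s : ℝ} (hs : 0 < s) :
    excessBound s 1 = (1 / 6 + 1 / (30 * (s + 1)) + 7 / (200 * ((s + 1) * (s + 2)))) / 2 := by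
  rw [excessBound, one_rpow]
  have h1 : s + 1 ≠ 0 := by positivity
  have h2 : s + 2 ≠ 0 := by positivity
  field_simp
  ring

/-- The numerical bounds leave a margin of only about 6·10⁻⁴ at s = √2. For s ≥ 2 the term 1/12 of
`excessBound s 1` already exceeds the tail at s = 2. -/
theorem cosTail_add_gaussTail_le {s : ℝ} (hs : √2 ≤ s) :
    cosTail s + gaussTail s π ≤ excessBound s 1 := by
  have h2 : (1.414 : ℝ) ≤ √2 := le_sqrt_of_sq_le (by norm_num)
  have hs1 : 1.414 ≤ s := h2.trans hs
  have hs0 : 0 < s := by linarith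
  have hG := gaussTail_pi_le (s := s) (by linarith)
  have c1 := cosTail_one_le
  have c2 := cosTail_two_le
  rw [excessBound_one_eq hs0]
  rcases le_total s 2 with h | h
  · have hc := cosTail_le_interpolation (s := s) (by linarith) h
    have hc' : cosTail s ≤ (2 - s) * 0.1039 + (s - 1) * 0.0742 := by
      refine hc.trans (add_le_add ?_ ?_)
      · exact mul_le_mul_of_nonneg_left c1 (by linarith)
      · exact mul_le_mul_of_nonneg_left c2 (by linarith)
    have h3 : (2 - s) * 0.1039 + (s - 1) * 0.0742 + 0.00014 ≤
        (1 / 6 + 1 / (30 * (s + 1)) + 7 / (200 * ((s + 1) * (s + 2)))) / 2 := by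
      have e : (1 / 6 + 1 / (30 * (s + 1)) + 7 / (200 * ((s + 1) * (s + 2)))) / 2 =
          (1 / 6 * ((s + 1) * (s + 2)) + (s + 2) / 30 + 7 / 200) / (2 * ((s + 1) * (s + 2))) := by
        field_simp
      rw [e, le_div_iff₀ (by positivity)]
      -- The difference of the two sides is a cubic in d with positive coefficients.
      obtain ⟨d, rfl⟩ : ∃ d, s = 1.414 + d := ⟨s - 1.414, by ring⟩
      have hd : 0 ≤ d := by linarith
      have hd3 : 0 ≤ d ^ 3 := by positivity
      nlinarith [sq_nonneg d]
    linarith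
  · have hc := cosTail_le_of_two_le h
    have : 0 ≤ 1 / (30 * (s + 1)) + 7 / (200 * ((s + 1) * (s + 2))) := by positivity
    norm_num at c2 hG
    linarith

/-- The weighted integral of `exp (-s t² / 2) - |cos t| ^ s` is nonnegative for `s ≥ √2`. -/
theorem integral_gaussCosDiff_nonneg {s p : ℝ} (hs : √2 ≤ s) (hp : 2 ≤ p) (hp' : p < 4) :
    0 ≤ ∫ t in Ioi 0, gaussCosDiff s t * t ^ (-p - 1) := by
  have h2 : (1 : ℝ) ≤ √2 := le_sqrt_of_sq_le (by norm_num)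
  have hs1 : 1 ≤ s := h2.trans hs
  refine integral_gaussCosDiff_mul_rpow_nonneg hs1 hp hp' ?_
  linarith [excessBound_sub_cosTail_le hs1, cosTail_add_gaussTail_le hs]

end CosineTail

/-! ### Absolute moments from the characteristic function. -/

section MomentFormula
open Real Set Filter Topology

/-- The second order Taylor remainder of the cosine. -/
noncomputable def cosRemainder (u : ℝ) : ℝ := cos u - 1 + u ^ 2 / 2

theorem continuous_cosRemainder : Continuous cosRemainder := by
  unfold cosRemainder; fun_prop

theorem cosRemainder_nonneg (u : ℝ) : 0 ≤ cosRemainder u := by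
  have := one_sub_sq_div_two_le_cos (x := u)
  unfold cosRemainder; linarith

theorem cosRemainder_pos {u : ℝ} (hu : u ≠ 0) : 0 < cosRemainder u := by
  have := one_sub_sq_div_two_lt_cos hu
  unfold cosRemainder; linarith

theorem cosRemainder_le_sq (u : ℝ) : cosRemainder u ≤ u ^ 2 / 2 := by
  have := cos_le_one u
  unfold cosRemainder; linarith

theorem cosRemainder_le_pow_four (u : ℝ) : cosRemainder u ≤ u ^ 4 / 24 := by
  have := cos_le_taylor_four (abs_nonneg u)
  rw [cos_abs, sq_abs, Even.pow_abs (by decide)] at this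
  unfold cosRemainder; linarith

/-- The bound u⁴/24 near 0 requires p < 4, and the bound u²/2 at infinity requires p > 2. -/
theorem integrableOn_cosRemainder_mul_rpow {p : ℝ} (hp : 2 < p) (hp' : p < 4) :
    IntegrableOn (fun u => cosRemainder u * u ^ (-p - 1)) (Ioi 0) := by
  have hmeas : Measurable (fun u => cosRemainder u * u ^ (-p - 1)) :=
    continuous_cosRemainder.measurable.mul (measurable_id.pow_const _)
  rw [← Ioc_union_Ioi_eq_Ioi zero_le_one]
  refine IntegrableOn.union ?_ ?_
  · have h : IntegrableOn (fun t : ℝ => 1 / 24 * t ^ (4 + (-p - 1))) (Ioc 0 1) :=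
      ((intervalIntegral.intervalIntegrable_rpow' (by linarith)).1).const_mul _
    refine h.mono' hmeas.aestronglyMeasurable
      ((ae_restrict_iff' measurableSet_Ioc).2 (Eventually.of_forall fun t ht => ?_))
    have h0 : 0 ≤ t ^ (-p - 1) := rpow_nonneg ht.1.le _
    rw [norm_of_nonneg (mul_nonneg (cosRemainder_nonneg t) h0), rpow_add ht.1, ← mul_assoc]
    refine mul_le_mul_of_nonneg_right ?_ h0
    have := cosRemainder_le_pow_four t
    have e : t ^ (4 : ℝ) = t ^ 4 := by norm_cast
    rw [e]; linarith
  · have h : IntegrableOn (fun t : ℝ => 1 / 2 * t ^ (2 + (-p - 1))) (Ioi 1) :=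
      (integrableOn_Ioi_rpow_of_lt (by linarith) one_pos).const_mul _
    refine h.mono' hmeas.aestronglyMeasurable
      ((ae_restrict_iff' measurableSet_Ioi).2 (Eventually.of_forall fun t ht => ?_))
    have ht0 : 0 < t := one_pos.trans ht
    have h0 : 0 ≤ t ^ (-p - 1) := rpow_nonneg ht0.le _
    rw [norm_of_nonneg (mul_nonneg (cosRemainder_nonneg t) h0), rpow_add ht0, ← mul_assoc]
    refine mul_le_mul_of_nonneg_right ?_ h0
    have := cosRemainder_le_sq t
    have e : t ^ (2 : ℝ) = t ^ 2 := by norm_cast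
    rw [e]; linarith

/-- The constant in `|x| ^ p * momentConst p = ∫_0^∞ (cos (t x) - 1 + (t x)² / 2) t^(-p-1) dt`. -/
noncomputable def momentConst (p : ℝ) : ℝ := ∫ u in Ioi 0, cosRemainder u * u ^ (-p - 1)

theorem momentConst_pos {p : ℝ} (hp : 2 < p) (hp' : p < 4) : 0 < momentConst p := by
  have hi := integrableOn_cosRemainder_mul_rpow hp hp'
  refine (setIntegral_pos_iff_support_of_nonneg_ae ?_ hi).2 ?_
  · refine (ae_restrict_iff' measurableSet_Ioi).2 (Eventually.of_forall fun t ht => ?_)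
    exact mul_nonneg (cosRemainder_nonneg t) (rpow_nonneg (le_of_lt ht) _)
  · have : Ioi (0 : ℝ) ⊆ Function.support (fun u => cosRemainder u * u ^ (-p - 1)) ∩ Ioi 0 := by
      intro t ht
      have ht' : 0 < t := ht
      exact ⟨(mul_pos (cosRemainder_pos ht'.ne') (rpow_pos_of_pos ht' _)).ne', ht⟩
    refine lt_of_lt_of_le ?_ (measure_mono this)
    simp

/-- Substitute u = |x|t. The remainder is nonnegative, so the `lintegral` form allows Tonelli's
theorem later without integrability of |X|^p. -/
theorem lintegral_cosRemainder_mul_rpow {p : ℝ} (hp : 2 < p) (hp' : p < 4) (x : ℝ) :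
    ∫⁻ t in Ioi 0, ENNReal.ofReal (cosRemainder (t * x) * t ^ (-p - 1)) =
      ENNReal.ofReal (|x| ^ p * momentConst p) := by
  rcases eq_or_ne x 0 with rfl | hx
  · simp [cosRemainder, zero_rpow (by linarith : p ≠ 0)]
  have hx' : 0 < |x| := abs_pos.2 hx
  have hi := integrableOn_cosRemainder_mul_rpow hp hp'
  have e : ∀ t ∈ Ioi (0 : ℝ), cosRemainder (t * x) * t ^ (-p - 1) =
      |x| ^ (p + 1) * (cosRemainder (|x| * t) * (|x| * t) ^ (-p - 1)) := by
    intro t ht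
    have e1 : cosRemainder (|x| * t) = cosRemainder (t * x) := by
      unfold cosRemainder
      rw [mul_pow, sq_abs, ← cos_abs (|x| * t), ← cos_abs (t * x), abs_mul, abs_mul, abs_abs,
        mul_comm |x|]
      ring
    have e2 : |x| ^ (p + 1) * |x| ^ (-p - 1) = 1 := by
      rw [← rpow_add hx']; ring_nf; exact rpow_zero _
    rw [e1, mul_rpow hx'.le (le_of_lt ht)]
    linear_combination (-cosRemainder (t * x) * t ^ (-p - 1)) * e2
  have hi2 := (integrableOn_Ioi_comp_mul_left_iff
    (fun u => cosRemainder u * u ^ (-p - 1)) 0 hx').2 (by simpa using hi)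
  have hI : IntegrableOn (fun t => cosRemainder (t * x) * t ^ (-p - 1)) (Ioi 0) :=
    (IntegrableOn.congr_fun (hi2.const_mul (|x| ^ (p + 1))) (fun t ht => (e t ht).symm)
      measurableSet_Ioi)
  rw [← ofReal_integral_eq_lintegral_ofReal hI]
  · congr 1
    rw [setIntegral_congr_fun measurableSet_Ioi e, integral_const_mul,
      integral_comp_mul_left_Ioi (fun u => cosRemainder u * u ^ (-p - 1)) 0 hx', mul_zero,
      smul_eq_mul, ← momentConst, rpow_add_one hx'.ne']
    field_simp
  · refine (ae_restrict_iff' measurableSet_Ioi).2 (Eventually.of_forall fun t ht => ?_)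
    exact mul_nonneg (cosRemainder_nonneg _) (rpow_nonneg (le_of_lt ht) _)

variable {Ω : Type*} [MeasurableSpace Ω] {P : Measure Ω} [IsProbabilityMeasure P] {X : Ω → ℝ}

theorem integrable_cos_mul (hX : Measurable X) (t : ℝ) : Integrable (fun ω => cos (t * X ω)) P := by
  refine Integrable.of_bound (C := 1) (by fun_prop) (Eventually.of_forall fun ω => ?_)
  simpa using abs_cos_le_one _

theorem integral_cosRemainder (hX : Measurable X) (h2 : Integrable (fun ω => X ω ^ 2) P) (t : ℝ) :
    ∫ ω, cosRemainder (t * X ω) ∂P =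
      ∫ ω, cos (t * X ω) ∂P - 1 + t ^ 2 / 2 * ∫ ω, X ω ^ 2 ∂P := by
  have e : ∀ ω, cosRemainder (t * X ω) = cos (t * X ω) - 1 + t ^ 2 / 2 * X ω ^ 2 := by
    intro ω; unfold cosRemainder; ring
  simp only [e]
  have hc := integrable_cos_mul (P := P) hX t
  have hs : Integrable (fun ω => cos (t * X ω) - 1) P := hc.sub (integrable_const 1)
  rw [integral_add hs (h2.const_mul _),
    integral_sub hc (integrable_const 1), integral_const_mul]
  simp

/-- Absolute moments of order between `2` and `4` in terms of the characteristic function. -/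
theorem lintegral_abs_rpow_eq {p : ℝ} (hp : 2 < p) (hp' : p < 4) (hX : Measurable X)
    (h2 : Integrable (fun ω => X ω ^ 2) P) :
    ∫⁻ ω, ENNReal.ofReal (|X ω| ^ p * momentConst p) ∂P =
      ∫⁻ t in Ioi 0, ENNReal.ofReal ((∫ ω, cos (t * X ω) ∂P - 1 + t ^ 2 / 2 * ∫ ω, X ω ^ 2 ∂P) *
        t ^ (-p - 1)) := by
  simp only [← lintegral_cosRemainder_mul_rpow hp hp']
  rw [lintegral_lintegral_swap]
  · refine setLIntegral_congr_fun measurableSet_Ioi fun t ht => ?_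
    rw [← integral_cosRemainder hX h2, ← integral_mul_const, ofReal_integral_eq_lintegral_ofReal]
    · refine Integrable.mul_const ?_ _
      refine (h2.const_mul (t ^ 2 / 2)).mono'
        (continuous_cosRemainder.measurable.comp (by fun_prop)).aestronglyMeasurable
        (Eventually.of_forall fun ω => ?_)
      rw [norm_of_nonneg (cosRemainder_nonneg _)]
      refine (cosRemainder_le_sq _).trans_eq ?_
      ring
    · exact Eventually.of_forall fun ω =>
        mul_nonneg (cosRemainder_nonneg _) (rpow_nonneg (le_of_lt ht) _)
  · refine Measurable.aemeasurable (Measurable.ennreal_ofReal (Measurable.mul ?_ ?_))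
    · exact continuous_cosRemainder.measurable.comp
        (measurable_snd.mul (hX.comp measurable_fst))
    · exact measurable_snd.pow_const _

/-- The absolute moment of order `p` of a standard Gaussian. -/
noncomputable def gaussMoment (p : ℝ) : ℝ := 2 ^ (p / 2) * (Gamma ((p + 1) / 2) / √π)

theorem lintegral_abs_rpow_gaussianReal {p : ℝ} (hp : 2 < p) (hp' : p < 4) :
    ∫⁻ x, ENNReal.ofReal (|x| ^ p * momentConst p) ∂(gaussianReal 0 1) =
      ENNReal.ofReal (gaussMoment p * momentConst p) := by
  have hM := (momentConst_pos hp hp').le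
  have hint : Integrable (fun x : ℝ => |x| ^ p) (gaussianReal 0 1) := by
    have h := (memLp_id_gaussianReal' (μ := 0) (v := 1) (ENNReal.ofReal p)
      ENNReal.ofReal_ne_top).integrable_norm_rpow (by simp; linarith) ENNReal.ofReal_ne_top
    simpa [ENNReal.toReal_ofReal (by linarith : (0 : ℝ) ≤ p)] using h
  rw [← ofReal_integral_eq_lintegral_ofReal (hint.mul_const _)
    (Eventually.of_forall fun x => by positivity), integral_mul_const]
  congr 2
  rw [integral_gaussianReal_eq_integral_smul one_ne_zero]
  have e : ∀ x : ℝ, gaussianPDFReal 0 1 x • |x| ^ p =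
      (√(2 * π))⁻¹ * (|x| ^ p * exp (-(1 / 2) * |x| ^ (2 : ℝ))) := by
    intro x
    have e2 : |x| ^ (2 : ℝ) = x ^ 2 := by rw [rpow_two, sq_abs]
    rw [gaussianPDFReal, e2, smul_eq_mul]
    simp only [NNReal.coe_one, mul_one, sub_zero]
    have e3 : -x ^ 2 / 2 = -(1 / 2) * x ^ 2 := by ring
    rw [e3]
    ring
  simp only [e]
  rw [integral_const_mul, integral_comp_abs (f := fun x => x ^ p * exp (-(1 / 2) * x ^ (2 : ℝ))),
    integral_rpow_mul_exp_neg_mul_rpow two_pos (by linarith) (by norm_num), gaussMoment]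
  have e4 : (1 / 2 : ℝ) ^ (-(p + 1) / 2) = 2 ^ (p / 2) * √2 := by
    rw [one_div, inv_rpow zero_le_two, ← rpow_neg zero_le_two, sqrt_eq_rpow,
      ← rpow_add two_pos]
    congr 1; ring
  rw [e4, sqrt_mul zero_le_two]
  field_simp

theorem integral_cos_gaussianReal (t : ℝ) :
    ∫ x, cos (t * x) ∂(gaussianReal 0 1) = exp (-t ^ 2 / 2) := by
  have h := charFun_gaussianReal (μ := 0) (v := 1) t
  rw [charFun_apply_real] at h
  have h2 := congrArg Complex.re h
  have hI : Integrable (fun x : ℝ => Complex.exp (t * x * Complex.I)) (gaussianReal 0 1) := by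
    refine Integrable.of_bound (C := 1) (by fun_prop) (Eventually.of_forall fun x => ?_)
    rw [← Complex.ofReal_mul, Complex.norm_exp_ofReal_mul_I]
  have h3 : (∫ x : ℝ, Complex.exp (t * x * Complex.I) ∂(gaussianReal 0 1)).re =
      ∫ x : ℝ, (Complex.exp (t * x * Complex.I)).re ∂(gaussianReal 0 1) :=
    (integral_re hI).symm
  rw [h3] at h2
  have e : ∀ x : ℝ, (Complex.exp (t * x * Complex.I)).re = cos (t * x) := by
    intro x; rw [← Complex.ofReal_mul, Complex.exp_ofReal_mul_I_re]
  simp only [e] at h2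
  rw [h2]
  have e2 : (t : ℂ) * ((0 : ℝ) : ℂ) * Complex.I - ((1 : NNReal) : ℝ) * (t : ℂ) ^ 2 / 2 =
      ((-t ^ 2 / 2 : ℝ) : ℂ) := by
    push_cast; ring
  rw [e2, Complex.exp_ofReal_re]

theorem integral_sq_gaussianReal : ∫ x, x ^ 2 ∂(gaussianReal 0 1) = 1 := by
  have h := variance_fun_id_gaussianReal (μ := 0) (v := 1)
  rw [variance_eq_integral (by fun_prop), integral_id_gaussianReal] at h
  simpa using h

/-- The Gaussian moment in terms of the Gaussian characteristic function. -/
theorem lintegral_gaussian_remainder {p : ℝ} (hp : 2 < p) (hp' : p < 4) :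
    ∫⁻ t in Ioi 0, ENNReal.ofReal ((exp (-t ^ 2 / 2) - 1 + t ^ 2 / 2) * t ^ (-p - 1)) =
      ENNReal.ofReal (gaussMoment p * momentConst p) := by
  have h2 : Integrable (fun x : ℝ => x ^ 2) (gaussianReal 0 1) := by
    have h := (memLp_id_gaussianReal (μ := 0) (v := 1) 2).integrable_sq
    simpa using h
  have h := lintegral_abs_rpow_eq (P := gaussianReal 0 1) hp hp' measurable_id h2
  simp only [id, integral_cos_gaussianReal, integral_sq_gaussianReal, mul_one,
    lintegral_abs_rpow_gaussianReal hp hp'] at h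
  exact h.symm

theorem exp_remainder_nonneg (t : ℝ) : 0 ≤ exp (-t ^ 2 / 2) - 1 + t ^ 2 / 2 := by
  linarith [add_one_le_exp (-t ^ 2 / 2)]

/-- The integrand is nonnegative and its integral is a finite Gaussian moment by the moment formula.
-/
theorem integrableOn_gaussian_remainder {p : ℝ} (hp : 2 < p) (hp' : p < 4) :
    IntegrableOn (fun t : ℝ => (exp (-t ^ 2 / 2) - 1 + t ^ 2 / 2) * t ^ (-p - 1)) (Ioi 0) := by
  have hmeas : Measurable (fun t : ℝ => (exp (-t ^ 2 / 2) - 1 + t ^ 2 / 2) * t ^ (-p - 1)) :=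
    Measurable.mul (by fun_prop) (measurable_id.pow_const _)
  refine (lintegral_ofReal_ne_top_iff_integrable hmeas.aestronglyMeasurable ?_).1 ?_
  · refine (ae_restrict_iff' measurableSet_Ioi).2 (Eventually.of_forall fun t ht => ?_)
    exact mul_nonneg (exp_remainder_nonneg t) (rpow_nonneg (le_of_lt ht) _)
  · rw [lintegral_gaussian_remainder hp hp']
    exact ENNReal.ofReal_ne_top

theorem integral_gaussian_remainder {p : ℝ} (hp : 2 < p) (hp' : p < 4) :
    ENNReal.ofReal (∫ t in Ioi 0, (exp (-t ^ 2 / 2) - 1 + t ^ 2 / 2) * t ^ (-p - 1)) =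
      ENNReal.ofReal (gaussMoment p * momentConst p) := by
  rw [← lintegral_gaussian_remainder hp hp',
    ofReal_integral_eq_lintegral_ofReal (integrableOn_gaussian_remainder hp hp')]
  refine (ae_restrict_iff' measurableSet_Ioi).2 (Eventually.of_forall fun t ht => ?_)
  exact mul_nonneg (exp_remainder_nonneg t) (rpow_nonneg (le_of_lt ht) _)

end MomentFormula

/-! ### Rademacher sums: characteristic function, second and fourth moments. -/

section Rademacher
open Real Set Filter Topology

variable {Ω : Type*} {ε : ℕ → Ω → ℝ}

/-- The partial sums `∑_{k < n} b k ε_k`. -/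
def rademacherSum (ε : ℕ → Ω → ℝ) (b : ℕ → ℝ) (n : ℕ) (ω : Ω) : ℝ :=
  ∑ k ∈ Finset.range n, b k * ε k ω

theorem rademacherSum_succ (b : ℕ → ℝ) (n : ℕ) (ω : Ω) :
    rademacherSum ε b (n + 1) ω = rademacherSum ε b n ω + b n * ε n ω :=
  Finset.sum_range_succ _ _

variable [MeasurableSpace Ω] {P : Measure Ω}

theorem IsRademacherSequence.measurable_sum (h : IsRademacherSequence P ε) (b : ℕ → ℝ) (n : ℕ) :
    Measurable (rademacherSum ε b n) :=
  Finset.measurable_fun_sum _ fun k _ => (h.measurable k).const_mul _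

theorem IsRademacherSequence.indepFun_sum (h : IsRademacherSequence P ε) (b : ℕ → ℝ) (n : ℕ) :
    IndepFun (rademacherSum ε b n) (ε n) P := by
  have h1 := h.indep.indepFun_finset (Finset.range n) {n} (by simp) h.measurable
  have hφ : Measurable (fun v : Finset.range n → ℝ =>
      ∑ k : Finset.range n, b k * v k) := by fun_prop
  have hψ : Measurable (fun v : ({n} : Finset ℕ) → ℝ => v ⟨n, Finset.mem_singleton_self n⟩) :=
    measurable_pi_apply _
  have h2 := h1.comp hφ hψ
  have e : rademacherSum ε b n = (fun v : Finset.range n → ℝ =>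
      ∑ k : Finset.range n, b k * v k) ∘ fun ω i => ε i ω := by
    ext ω
    exact (Finset.sum_coe_sort (Finset.range n) (fun k => b k * ε k ω)).symm
  rw [e]
  exact h2

variable [IsProbabilityMeasure P]

theorem IsRademacherSequence.ae_eq (h : IsRademacherSequence P ε) (k : ℕ) :
    ∀ᵐ ω ∂P, ε k ω = 1 ∨ ε k ω = -1 := by
  have m1 : MeasurableSet {ω | ε k ω = 1} := h.measurable k (measurableSet_singleton 1)
  have m2 : MeasurableSet {ω | ε k ω = -1} := h.measurable k (measurableSet_singleton (-1))
  have hd : Disjoint {ω | ε k ω = 1} {ω | ε k ω = -1} := by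
    rw [Set.disjoint_left]
    intro ω h1 h2
    have h1 : ε k ω = 1 := h1
    have h2 : ε k ω = -1 := h2
    linarith
  have hu : P ({ω | ε k ω = 1} ∪ {ω | ε k ω = -1}) = 1 := by
    rw [measure_union hd m2, h.prob_one, h.prob_neg_one, ENNReal.add_halves]
  exact (mem_ae_iff_prob_eq_one (m1.union m2)).2 hu

theorem IsRademacherSequence.integral_eq_zero (h : IsRademacherSequence P ε) (k : ℕ) :
    ∫ ω, ε k ω ∂P = 0 := by
  have m1 : MeasurableSet {ω | ε k ω = 1} := h.measurable k (measurableSet_singleton 1)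
  have m2 : MeasurableSet {ω | ε k ω = -1} := h.measurable k (measurableSet_singleton (-1))
  have e : ε k =ᵐ[P] fun ω => {ω | ε k ω = 1}.indicator (fun _ => (1 : ℝ)) ω -
      {ω | ε k ω = -1}.indicator (fun _ => (1 : ℝ)) ω := by
    filter_upwards [h.ae_eq k] with ω hω
    rcases hω with hω | hω
    · norm_num [indicator, hω]
    · norm_num [indicator, hω]
  rw [integral_congr_ae e, integral_sub ((integrable_const 1).indicator m1)
    ((integrable_const 1).indicator m2), integral_indicator_const _ m1,
    integral_indicator_const _ m2, measureReal_def, measureReal_def, h.prob_one, h.prob_neg_one]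
  simp

theorem IsRademacherSequence.ae_abs_sum_le (h : IsRademacherSequence P ε) (b : ℕ → ℝ) (n : ℕ) :
    ∀ᵐ ω ∂P, |rademacherSum ε b n ω| ≤ ∑ k ∈ Finset.range n, |b k| := by
  filter_upwards [ae_all_iff.2 h.ae_eq] with ω hω
  refine (Finset.abs_sum_le_sum_abs _ _).trans (Finset.sum_le_sum fun k _ => ?_)
  rw [abs_mul]
  rcases hω k with e | e <;> simp [e]

theorem IsRademacherSequence.integrable_comp_sum (h : IsRademacherSequence P ε) (b : ℕ → ℝ)
    (n : ℕ) {g : ℝ → ℝ} (hg : Continuous g) :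
    Integrable (fun ω => g (rademacherSum ε b n ω)) P := by
  obtain ⟨C, hC⟩ := (isCompact_Icc (a := -∑ k ∈ Finset.range n, |b k|)
    (b := ∑ k ∈ Finset.range n, |b k|)).exists_bound_of_continuousOn hg.continuousOn
  refine Integrable.of_bound (C := C)
    (hg.measurable.comp (h.measurable_sum b n)).aestronglyMeasurable ?_
  filter_upwards [h.ae_abs_sum_le b n] with ω hω
  exact hC _ (abs_le.1 hω)

theorem IsRademacherSequence.integral_comp_sum_mul (h : IsRademacherSequence P ε) (b : ℕ → ℝ)
    (n : ℕ) {g : ℝ → ℝ} (hg : Continuous g) :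
    ∫ ω, g (rademacherSum ε b n ω) * ε n ω ∂P = 0 := by
  have h1 := (h.indepFun_sum b n).comp (φ := g) (ψ := id) hg.measurable measurable_id
  have h2 := h1.integral_fun_mul_eq_mul_integral
    (hg.measurable.comp (h.measurable_sum b n)).aestronglyMeasurable
    (h.measurable n).aestronglyMeasurable
  simp only [Function.comp, id] at h2
  rw [h2]
  have := h.integral_eq_zero n
  simp only [this, mul_zero]

theorem IsRademacherSequence.integrable_comp_sum_mul (h : IsRademacherSequence P ε) (b : ℕ → ℝ)
    (n : ℕ) {g : ℝ → ℝ} (hg : Continuous g) :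
    Integrable (fun ω => g (rademacherSum ε b n ω) * ε n ω) P := by
  refine (h.integrable_comp_sum b n hg).mul_bdd (c := 1) (h.measurable n).aestronglyMeasurable ?_
  filter_upwards [h.ae_eq n] with ω hω
  rcases hω with e | e <;> simp [e]

/-- Integrating out the last sign. -/
theorem IsRademacherSequence.integral_succ (h : IsRademacherSequence P ε) (b : ℕ → ℝ) (n : ℕ)
    {F g₀ g₁ : ℝ → ℝ} (hg₀ : Continuous g₀) (hg₁ : Continuous g₁)
    (hF : ∀ x e, e = 1 ∨ e = -1 → F (x + b n * e) = g₀ x + g₁ x * e) :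
    ∫ ω, F (rademacherSum ε b (n + 1) ω) ∂P = ∫ ω, g₀ (rademacherSum ε b n ω) ∂P := by
  -- The part linear in ε_n has mean zero, because ε_n is centred and independent of the preceding
  -- sum.
  have e : (fun ω => F (rademacherSum ε b (n + 1) ω)) =ᵐ[P]
      fun ω => g₀ (rademacherSum ε b n ω) + g₁ (rademacherSum ε b n ω) * ε n ω := by
    filter_upwards [h.ae_eq n] with ω hω
    rw [rademacherSum_succ, hF _ _ hω]
  rw [integral_congr_ae e, integral_add (h.integrable_comp_sum b n hg₀)
    (h.integrable_comp_sum_mul b n hg₁), h.integral_comp_sum_mul b n hg₁, add_zero]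

theorem IsRademacherSequence.integral_cos (h : IsRademacherSequence P ε) (b : ℕ → ℝ) (t : ℝ)
    (n : ℕ) : ∫ ω, cos (t * rademacherSum ε b n ω) ∂P =
      ∏ k ∈ Finset.range n, cos (b k * t) := by
  induction n with
  | zero => simp [rademacherSum]
  | succ n ih =>
    rw [h.integral_succ b n (F := fun x => cos (t * x)) (g₀ := fun x => cos (b n * t) * cos (t * x))
      (g₁ := fun x => -(sin (b n * t) * sin (t * x))) (by fun_prop) (by fun_prop),
      integral_const_mul, ih, Finset.prod_range_succ, mul_comm]
    intro x e he
    have e1 : t * (x + b n * e) = t * x + e * (b n * t) := by ring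
    rw [e1, cos_add]
    rcases he with rfl | rfl
    · rw [one_mul]; ring
    · rw [neg_one_mul, cos_neg, sin_neg]; ring

theorem IsRademacherSequence.integral_sq (h : IsRademacherSequence P ε) (b : ℕ → ℝ) (n : ℕ) :
    ∫ ω, rademacherSum ε b n ω ^ 2 ∂P = ∑ k ∈ Finset.range n, b k ^ 2 := by
  induction n with
  | zero => simp [rademacherSum]
  | succ n ih =>
    have hi := h.integrable_comp_sum b n (g := fun x => x ^ 2) (by fun_prop)
    rw [h.integral_succ b n (F := fun x => x ^ 2) (g₀ := fun x => x ^ 2 + b n ^ 2)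
      (g₁ := fun x => 2 * b n * x) (by fun_prop) (by fun_prop),
      integral_add hi (integrable_const _), ih, Finset.sum_range_succ]
    · simp
    · intro x e he
      rcases he with rfl | rfl <;> ring

theorem IsRademacherSequence.integral_pow_four (h : IsRademacherSequence P ε) (b : ℕ → ℝ)
    (n : ℕ) : ∫ ω, rademacherSum ε b n ω ^ 4 ∂P =
      3 * (∑ k ∈ Finset.range n, b k ^ 2) ^ 2 - 2 * ∑ k ∈ Finset.range n, b k ^ 4 := by
  induction n with
  | zero => simp [rademacherSum]
  | succ n ih =>
    have hi := h.integrable_comp_sum b n (g := fun x => x ^ 4) (by fun_prop)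
    have hi2 := h.integrable_comp_sum b n (g := fun x => 6 * b n ^ 2 * x ^ 2) (by fun_prop)
    have hi3 := h.integrable_comp_sum b n (g := fun x => x ^ 4 + 6 * b n ^ 2 * x ^ 2)
      (by fun_prop)
    rw [h.integral_succ b n (F := fun x => x ^ 4)
      (g₀ := fun x => x ^ 4 + 6 * b n ^ 2 * x ^ 2 + b n ^ 4)
      (g₁ := fun x => 4 * b n * x ^ 3 + 4 * b n ^ 3 * x) (by fun_prop) (by fun_prop),
      integral_add hi3 (integrable_const _), integral_add hi hi2, integral_const_mul, ih,
      h.integral_sq, Finset.sum_range_succ, Finset.sum_range_succ]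
    · simp
      ring
    · intro x e he
      rcases he with rfl | rfl <;> ring

end Rademacher

/-! ### The lower bound Γ ≥ Γ(3/2) on [3/2, ∞). -/

section GammaBound
open Real Set

/-- Equivalent to Γ'(3/2) ≥ 0. The index 16 is the first power of two at which H_n - log n is small
enough, and log 16 = 4 log 2. -/
theorem eulerMascheroniConstant_le_two_sub : eulerMascheroniConstant ≤ 2 - 2 * log 2 := by
  have h := eulerMascheroniConstant_lt_eulerMascheroniSeq' 16
  have h1 : eulerMascheroniSeq' 16 = 2436559 / 720720 - log 16 := by
    rw [eulerMascheroniSeq']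
    norm_num [harmonic, Finset.sum_range_succ]
  have h2 : log 16 = 4 * log 2 := by
    rw [show (16 : ℝ) = 2 ^ 4 by norm_num, log_pow]; norm_num
  rw [h1, h2] at h
  have h3 := log_two_gt_d9
  norm_num at h h3 ⊢
  linarith

theorem hasDerivAt_Gamma_three_halves :
    HasDerivAt Gamma (√π * (1 - (eulerMascheroniConstant + 2 * log 2) / 2)) (3 / 2) := by
  have h1 : HasDerivAt (fun x => (x - 1) * Gamma (x - 1))
      (√π * (1 - (eulerMascheroniConstant + 2 * log 2) / 2)) (3 / 2) := by
    have e : (3 / 2 : ℝ) - 1 = 1 / 2 := by norm_num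
    have h0 : HasDerivAt Gamma (-√π * (eulerMascheroniConstant + 2 * log 2)) (3 / 2 - 1) := by
      rw [e]; exact hasDerivAt_Gamma_one_half
    refine (((hasDerivAt_id (3 / 2 : ℝ)).sub_const 1).mul
      (h0.comp (3 / 2) ((hasDerivAt_id (3 / 2 : ℝ)).sub_const 1))).congr_deriv ?_
    simp only [id, Function.comp, e, Gamma_one_half_eq]
    ring
  refine h1.congr_of_eventuallyEq ?_
  filter_upwards [Ioi_mem_nhds (by norm_num : (1 : ℝ) < 3 / 2)] with x hx
  have hx : 1 < x := hx
  have := Gamma_add_one (s := x - 1) (by linarith)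
  rwa [sub_add_cancel] at this

/-- Γ is convex with nonnegative slope at 3/2, so it lies above its value there. -/
theorem Gamma_three_halves_le {x : ℝ} (hx : 3 / 2 ≤ x) : √π / 2 ≤ Gamma x := by
  have h32 : Gamma (3 / 2) = √π / 2 := by
    have := Gamma_add_one (s := 1 / 2) (by norm_num)
    rw [Gamma_one_half_eq] at this
    rw [show (3 / 2 : ℝ) = 1 / 2 + 1 by norm_num, this]; ring
  rcases hx.eq_or_lt with rfl | hx
  · exact h32.ge
  have hs := convexOn_Gamma.le_slope_of_hasDerivAt (x := 3 / 2) (y := x)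
    (by norm_num [mem_Ioi]) (by rw [mem_Ioi]; linarith) hx hasDerivAt_Gamma_three_halves
  have hd : 0 ≤ √π * (1 - (eulerMascheroniConstant + 2 * log 2) / 2) :=
    mul_nonneg (sqrt_nonneg _) (by linarith [eulerMascheroniConstant_le_two_sub])
  have := hd.trans hs
  rw [slope_def_field, le_div_iff₀ (by linarith)] at this
  linarith

end GammaBound

/-! ### The sharp Khintchine inequality. -/

section Khintchine
open Real Set Filter Topology

theorem sum_fin_eq_rademacherSum {Ω : Type*} {ε : ℕ → Ω → ℝ} {n : ℕ} (a : Fin n → ℝ) (ω : Ω) :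
    ∑ k : Fin n, a k * ε k ω =
      rademacherSum ε (fun k => if h : k < n then a ⟨k, h⟩ else 0) n ω := by
  rw [rademacherSum, Finset.sum_range]
  simp

variable {Ω : Type*} [MeasurableSpace Ω] {P : Measure Ω} [IsProbabilityMeasure P]
  {ε : ℕ → Ω → ℝ} {p : ℝ}

theorem gaussMoment_pos (hp : 0 < p) : 0 < gaussMoment p := by
  have := Gamma_pos_of_pos (s := (p + 1) / 2) (by linarith)
  unfold gaussMoment
  positivity

theorem two_rpow_le_gaussMoment (hp : 2 ≤ p) : 2 ^ ((p - 2) / 2) ≤ gaussMoment p := by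
  have h := Gamma_three_halves_le (x := (p + 1) / 2) (by linarith)
  have hpi : 0 < √π := sqrt_pos.2 pi_pos
  have h2 : 1 / 2 ≤ Gamma ((p + 1) / 2) / √π := by
    rw [le_div_iff₀ hpi]; linarith
  have e : (2 : ℝ) ^ ((p - 2) / 2) = 2 ^ (p / 2) * (1 / 2) := by
    rw [show (p - 2) / 2 = p / 2 - 1 by ring, rpow_sub_one two_ne_zero]; ring
  rw [e, gaussMoment]
  gcongr

theorem gaussMoment_rpow (hp : 0 < p) :
    gaussMoment p ^ (1 / p) = √2 * (Gamma ((p + 1) / 2) / √π) ^ (1 / p) := by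
  have := Gamma_pos_of_pos (s := (p + 1) / 2) (by linarith)
  rw [gaussMoment, mul_rpow (by positivity) (by positivity), ← rpow_mul zero_le_two, sqrt_eq_rpow 2]
  congr 2
  field_simp

/-- With θ = (p - 2)/2, |x|^p = 2^θ (x²)^(1-θ) (x⁴/2)^θ, followed by AM-GM. The fourth power is
halved because E S⁴ ≤ 2 in the case of a large coefficient, so both averages are then at most 1. -/
theorem abs_rpow_le_interpolation (hp : 2 ≤ p) (hp' : p ≤ 4) (x : ℝ) :
    |x| ^ p ≤ 2 ^ ((p - 2) / 2) * ((1 - (p - 2) / 2) * x ^ 2 + (p - 2) / 2 * (x ^ 4 / 2)) := by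
  set θ := (p - 2) / 2 with hθ
  have h0 : 0 ≤ θ := by rw [hθ]; linarith
  have h1 : 0 ≤ 1 - θ := by rw [hθ]; linarith
  have h := geom_mean_le_arith_mean2_weighted h1 h0 (sq_nonneg x)
    (by positivity : 0 ≤ x ^ 4 / 2) (by ring)
  have e : |x| ^ p = 2 ^ θ * ((x ^ 2) ^ (1 - θ) * (x ^ 4 / 2) ^ θ) := by
    rw [div_rpow (by positivity) zero_le_two, ← sq_abs x, ← Even.pow_abs (by decide : Even 4) x,
      ← rpow_natCast, ← rpow_natCast, ← rpow_mul (abs_nonneg x), ← rpow_mul (abs_nonneg x)]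
    have h2 : (2 : ℝ) ^ θ ≠ 0 := (rpow_pos_of_pos two_pos θ).ne'
    have h3 : |x| ^ p = |x| ^ ((2 : ℕ) * (1 - θ)) * |x| ^ ((4 : ℕ) * θ) := by
      rw [← rpow_add_of_nonneg (abs_nonneg x) (by positivity) (by positivity)]
      congr 1
      rw [hθ]; push_cast; ring
    rw [h3]
    field_simp
  rw [e]
  gcongr

theorem continuous_abs_rpow (hp : 0 ≤ p) : Continuous fun x : ℝ => |x| ^ p :=
  continuous_abs.rpow_const fun _ => Or.inr hp

/-- A large coefficient is handled by interpolation between the second and fourth moments. -/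
theorem IsRademacherSequence.integral_le_of_large (h : IsRademacherSequence P ε) (hp : 2 ≤ p)
    (hp' : p ≤ 4) {b : ℕ → ℝ} {n : ℕ} (hb : ∑ k ∈ Finset.range n, b k ^ 2 = 1)
    {j : ℕ} (hj : j ∈ Finset.range n) (hbj : 1 / 2 ≤ b j ^ 4) :
    ∫ ω, |rademacherSum ε b n ω| ^ p ∂P ≤ gaussMoment p := by
  have i2 := h.integrable_comp_sum b n (g := fun x => x ^ 2) (by fun_prop)
  have i4 := h.integrable_comp_sum b n (g := fun x => x ^ 4) (by fun_prop)
  have h4 : ∫ ω, rademacherSum ε b n ω ^ 4 ∂P ≤ 2 := by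
    rw [h.integral_pow_four, hb]
    have : b j ^ 4 ≤ ∑ k ∈ Finset.range n, b k ^ 4 :=
      Finset.single_le_sum (f := fun k => b k ^ 4) (fun k _ => by positivity) hj
    linarith
  have hθ : 0 ≤ (p - 2) / 2 := by linarith
  calc ∫ ω, |rademacherSum ε b n ω| ^ p ∂P
      ≤ ∫ ω, 2 ^ ((p - 2) / 2) * ((1 - (p - 2) / 2) * rademacherSum ε b n ω ^ 2 +
          (p - 2) / 2 * (rademacherSum ε b n ω ^ 4 / 2)) ∂P :=
        integral_mono (h.integrable_comp_sum b n (continuous_abs_rpow (by linarith)))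
          (((i2.const_mul _).add ((i4.div_const 2).const_mul _)).const_mul _)
          fun ω => abs_rpow_le_interpolation hp hp' _
    _ = 2 ^ ((p - 2) / 2) * ((1 - (p - 2) / 2) + (p - 2) / 2 *
          ((∫ ω, rademacherSum ε b n ω ^ 4 ∂P) / 2)) := by
        rw [integral_const_mul, integral_add (i2.const_mul _) ((i4.div_const 2).const_mul _),
          integral_const_mul, integral_const_mul, integral_div, h.integral_sq, hb, mul_one]
    _ ≤ 2 ^ ((p - 2) / 2) * 1 := by
        gcongr
        nlinarith
    _ ≤ gaussMoment p := by rw [mul_one]; exact two_rpow_le_gaussMoment hp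

/-- The moment formula for normalized Rademacher sums. -/
theorem IsRademacherSequence.lintegral_remainder (h : IsRademacherSequence P ε) (hp : 2 < p)
    (hp' : p < 4) {b : ℕ → ℝ} {n : ℕ} (hb : ∑ k ∈ Finset.range n, b k ^ 2 = 1) :
    ∫⁻ t in Ioi 0, ENNReal.ofReal ((∏ k ∈ Finset.range n, cos (b k * t) - 1 + t ^ 2 / 2) *
        t ^ (-p - 1)) =
      ENNReal.ofReal ((∫ ω, |rademacherSum ε b n ω| ^ p ∂P) * momentConst p) := by
  have hM := (momentConst_pos hp hp').le
  have e := lintegral_abs_rpow_eq (P := P) hp hp' (h.measurable_sum b n)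
    (h.integrable_comp_sum b n (g := fun x => x ^ 2) (by fun_prop))
  simp only [h.integral_cos, h.integral_sq, hb, mul_one] at e
  rw [← e, ← integral_mul_const, ofReal_integral_eq_lintegral_ofReal]
  · exact (h.integrable_comp_sum b n (continuous_abs_rpow (by linarith))).mul_const _
  · exact Eventually.of_forall fun ω => by positivity

/-- AM-GM with weights b_k² applied to |cos(b_k t)|^(1/b_k²); at scale b_k t the Gaussian
exp(-st²/2) with s = 1/b_k² is exp(-t²/2) for every k. -/
theorem prod_cos_le {b : ℕ → ℝ} {n : ℕ} (hb : ∑ k ∈ Finset.range n, b k ^ 2 = 1) (t : ℝ) :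
    ∏ k ∈ Finset.range n, cos (b k * t) ≤
      exp (-t ^ 2 / 2) - ∑ k ∈ Finset.range n, b k ^ 2 * gaussCosDiff (1 / b k ^ 2) (b k * t) := by
  have h := geom_mean_le_arith_mean_weighted (Finset.range n) (fun k => b k ^ 2)
    (fun k => |cos (b k * t)| ^ (1 / b k ^ 2)) (fun k _ => sq_nonneg _) hb
    (fun k _ => by positivity)
  have e1 : ∀ k, (|cos (b k * t)| ^ (1 / b k ^ 2)) ^ (b k ^ 2) = |cos (b k * t)| := by
    intro k
    -- For b_k = 0 the exponent 1/0 is 0, and both sides equal 1 since cos 0 = 1.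
    rcases eq_or_ne (b k) 0 with h0 | h0
    · simp [h0]
    · rw [← rpow_mul (abs_nonneg _), one_div_mul_cancel (by positivity), rpow_one]
  simp only [e1] at h
  have e2 : ∀ k, b k ^ 2 * gaussCosDiff (1 / b k ^ 2) (b k * t) =
      b k ^ 2 * exp (-t ^ 2 / 2) - b k ^ 2 * |cos (b k * t)| ^ (1 / b k ^ 2) := by
    intro k
    rcases eq_or_ne (b k) 0 with h0 | h0
    · simp [h0]
    · rw [gaussCosDiff, mul_sub]
      congr 3
      field_simp
  simp only [e2]
  rw [Finset.sum_sub_distrib, ← Finset.sum_mul, hb, one_mul, sub_sub_cancel]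
  refine le_trans ?_ h
  rw [← Finset.abs_prod]
  exact le_abs_self _

theorem gaussCosDiff_abs (s t : ℝ) : gaussCosDiff s |t| = gaussCosDiff s t := by
  rw [gaussCosDiff, gaussCosDiff, sq_abs, cos_abs]

theorem gaussCosDiff_scaled {s c : ℝ} (hc : c ≠ 0) (hs : √2 ≤ s) (hp : 2 ≤ p) (hp' : p < 4) :
    IntegrableOn (fun t => gaussCosDiff s (c * t) * t ^ (-p - 1)) (Ioi 0) ∧
      0 ≤ ∫ t in Ioi 0, gaussCosDiff s (c * t) * t ^ (-p - 1) := by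
  have hc' : 0 < |c| := abs_pos.2 hc
  have hs1 : 1 ≤ s := le_trans (le_sqrt_of_sq_le (by norm_num)) hs
  have e : ∀ t ∈ Ioi (0 : ℝ), gaussCosDiff s (c * t) * t ^ (-p - 1) =
      |c| ^ (p + 1) * (gaussCosDiff s (|c| * t) * (|c| * t) ^ (-p - 1)) := by
    intro t ht
    have ht : 0 < t := ht
    have e1 : gaussCosDiff s (|c| * t) = gaussCosDiff s (c * t) := by
      rw [← gaussCosDiff_abs s (c * t), abs_mul, abs_of_pos ht]
    have e2 : |c| ^ (p + 1) * |c| ^ (-p - 1) = 1 := by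
      rw [← rpow_add hc']; ring_nf; exact rpow_zero _
    rw [e1, mul_rpow hc'.le ht.le]
    linear_combination (-gaussCosDiff s (c * t) * t ^ (-p - 1)) * e2
  have hi := integrableOn_gaussCosDiff_mul_rpow (q := -p - 1) hs1 (by linarith) (by linarith)
  have hi2 := (integrableOn_Ioi_comp_mul_left_iff
    (fun u => gaussCosDiff s u * u ^ (-p - 1)) 0 hc').2 (by simpa using hi)
  refine ⟨IntegrableOn.congr_fun (hi2.const_mul (|c| ^ (p + 1))) (fun t ht => (e t ht).symm)
      measurableSet_Ioi, ?_⟩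
  rw [setIntegral_congr_fun measurableSet_Ioi e, integral_const_mul,
    integral_comp_mul_left_Ioi (fun u => gaussCosDiff s u * u ^ (-p - 1)) 0 hc', mul_zero,
    smul_eq_mul]
  have := integral_gaussCosDiff_nonneg hs hp hp'
  positivity

/-- The bound b_k⁴ ≤ 1/2 means 1/b_k² ≥ √2, so each term subtracted from the Gaussian in
`prod_cos_le` has nonnegative weighted integral. -/
theorem IsRademacherSequence.integral_le_of_small (h : IsRademacherSequence P ε) (hp : 2 < p)
    (hp' : p < 4) {b : ℕ → ℝ} {n : ℕ} (hb : ∑ k ∈ Finset.range n, b k ^ 2 = 1)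
    (hbs : ∀ k ∈ Finset.range n, b k ^ 4 ≤ 1 / 2) :
    ∫ ω, |rademacherSum ε b n ω| ^ p ∂P ≤ gaussMoment p := by
  have hM := momentConst_pos hp hp'
  let D : ℕ → ℝ → ℝ := fun k t => b k ^ 2 * (gaussCosDiff (1 / b k ^ 2) (b k * t) * t ^ (-p - 1))
  have hD : ∀ k ∈ Finset.range n, IntegrableOn (D k) (Ioi 0) ∧ 0 ≤ ∫ t in Ioi 0, D k t := by
    intro k hk
    rcases eq_or_ne (b k) 0 with h0 | h0
    · simp [D, h0]
    · have hs : √2 ≤ 1 / b k ^ 2 := by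
        rw [le_div_iff₀ (by positivity)]
        refine le_of_sq_le_sq ?_ zero_le_one
        rw [mul_pow, sq_sqrt zero_le_two]
        have := hbs k hk
        nlinarith
      obtain ⟨i, j⟩ := gaussCosDiff_scaled h0 hs hp.le hp'
      refine ⟨i.const_mul _, ?_⟩
      simp only [D]
      rw [integral_const_mul]
      exact mul_nonneg (sq_nonneg _) j
  let G : ℝ → ℝ := fun t => (exp (-t ^ 2 / 2) - 1 + t ^ 2 / 2) * t ^ (-p - 1)
  have hG : IntegrableOn G (Ioi 0) := integrableOn_gaussian_remainder hp hp'
  have hS : IntegrableOn (fun t => ∑ k ∈ Finset.range n, D k t) (Ioi 0) :=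
    integrable_finsetSum _ fun k hk => (hD k hk).1
  have hSint : 0 ≤ ∫ t in Ioi 0, ∑ k ∈ Finset.range n, D k t := by
    rw [integral_finsetSum _ fun k hk => (hD k hk).1]
    exact Finset.sum_nonneg fun k hk => (hD k hk).2
  have hle : ∀ t ∈ Ioi (0 : ℝ),
      (∏ k ∈ Finset.range n, cos (b k * t) - 1 + t ^ 2 / 2) * t ^ (-p - 1) ≤
        G t - ∑ k ∈ Finset.range n, D k t := by
    intro t ht
    have h0 : 0 ≤ t ^ (-p - 1) := rpow_nonneg (le_of_lt ht) _
    have e : G t - ∑ k ∈ Finset.range n, D k t = (exp (-t ^ 2 / 2) -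
        (∑ k ∈ Finset.range n, b k ^ 2 * gaussCosDiff (1 / b k ^ 2) (b k * t)) - 1 + t ^ 2 / 2) *
          t ^ (-p - 1) := by
      simp only [G, D, ← mul_assoc, ← Finset.sum_mul]
      ring
    rw [e]
    exact mul_le_mul_of_nonneg_right (by linarith [prod_cos_le hb t]) h0
  -- Nonnegativity passes to the majorant G - ∑ D_k, so its `lintegral` is the `ofReal` of its
  -- Bochner integral.
  have hnn : ∀ t, 0 < t →
      0 ≤ (∏ k ∈ Finset.range n, cos (b k * t) - 1 + t ^ 2 / 2) * t ^ (-p - 1) := by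
    intro t ht
    have e := integral_cosRemainder (P := P) (h.measurable_sum b n)
      (h.integrable_comp_sum b n (g := fun x => x ^ 2) (by fun_prop)) t
    rw [h.integral_cos, h.integral_sq, hb, mul_one] at e
    rw [← e]
    exact mul_nonneg (integral_nonneg fun ω => cosRemainder_nonneg _) (rpow_nonneg ht.le _)
  have key : ENNReal.ofReal ((∫ ω, |rademacherSum ε b n ω| ^ p ∂P) * momentConst p) ≤
      ENNReal.ofReal (gaussMoment p * momentConst p) := by
    rw [← h.lintegral_remainder hp hp' hb, ← integral_gaussian_remainder hp hp']
    calc _ ≤ ∫⁻ t in Ioi 0, ENNReal.ofReal (G t - ∑ k ∈ Finset.range n, D k t) :=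
          setLIntegral_mono' measurableSet_Ioi fun t ht => ENNReal.ofReal_le_ofReal (hle t ht)
      _ = ENNReal.ofReal (∫ t in Ioi 0, (G t - ∑ k ∈ Finset.range n, D k t)) := by
          have hGS : IntegrableOn (fun t => G t - ∑ k ∈ Finset.range n, D k t) (Ioi 0) :=
            hG.sub hS
          rw [ofReal_integral_eq_lintegral_ofReal hGS]
          exact (ae_restrict_iff' measurableSet_Ioi).2
            (Eventually.of_forall fun t ht => (hnn t ht).trans (hle t ht))
      _ ≤ _ := by
          refine ENNReal.ofReal_le_ofReal ?_
          rw [integral_sub hG hS]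
          linarith
  have hg := (gaussMoment_pos (p := p) (by linarith)).le
  rw [ENNReal.ofReal_le_ofReal_iff (by positivity)] at key
  exact le_of_mul_le_mul_right key hM

theorem IsRademacherSequence.integral_le (h : IsRademacherSequence P ε) (hp : 2 < p)
    (hp' : p < 4) {b : ℕ → ℝ} {n : ℕ} (hb : ∑ k ∈ Finset.range n, b k ^ 2 = 1) :
    ∫ ω, |rademacherSum ε b n ω| ^ p ∂P ≤ gaussMoment p := by
  by_cases hbs : ∀ k ∈ Finset.range n, b k ^ 4 ≤ 1 / 2
  · exact h.integral_le_of_small hp hp' hb hbs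
  · push Not at hbs
    obtain ⟨j, hj, hbj⟩ := hbs
    exact h.integral_le_of_large hp.le hp'.le hb hj hbj.le

/-- The bounds 1 - x²/2 ≤ cos x ≤ 1 - x²/2 + x⁴/24 squeeze n(cos(t/√n) - 1) to -t²/2. -/
theorem tendsto_cos_div_sqrt_pow (t : ℝ) :
    Tendsto (fun n : ℕ => cos (1 / √n * t) ^ n) atTop (𝓝 (exp (-t ^ 2 / 2))) := by
  have h : Tendsto (fun n : ℕ => n * (cos (1 / √n * t) - 1)) atTop (𝓝 (-t ^ 2 / 2)) := by
    have hu : Tendsto (fun n : ℕ => -t ^ 2 / 2 + t ^ 4 / 24 / n) atTop (𝓝 (-t ^ 2 / 2)) := by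
      have := (tendsto_const_div_atTop_nhds_zero_nat (t ^ 4 / 24)).const_add (-t ^ 2 / 2)
      rwa [add_zero] at this
    refine tendsto_of_tendsto_of_tendsto_of_le_of_le' tendsto_const_nhds hu ?_ ?_
    all_goals
      filter_upwards [eventually_gt_atTop 0] with n hn
      have hn : (0 : ℝ) < n := by exact_mod_cast hn
      have hsq : (1 / √n * t) ^ 2 = t ^ 2 / n := by
        rw [mul_pow, div_pow, sq_sqrt hn.le]; ring
    · have h1 := one_sub_sq_div_two_le_cos (x := 1 / √n * t)
      rw [hsq] at h1
      calc -t ^ 2 / 2 = n * (-(t ^ 2 / n / 2)) := by field_simp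
        _ ≤ _ := by gcongr; linarith
    · have h1 := cosRemainder_le_pow_four (1 / √n * t)
      have h4 : (1 / √n * t) ^ 4 = (t ^ 2 / n) ^ 2 := by rw [← hsq]; ring
      rw [cosRemainder, hsq, h4] at h1
      calc n * (cos (1 / √n * t) - 1) ≤ n * ((t ^ 2 / n) ^ 2 / 24 - t ^ 2 / n / 2) :=
            mul_le_mul_of_nonneg_left (by linarith) hn.le
        _ = _ := by field_simp; ring
  refine (tendsto_one_add_pow_exp_of_tendsto h).congr fun n => ?_
  ring

/-- Lower bound for the constant, from equal coefficients. -/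
theorem IsRademacherSequence.gaussMoment_le (h : IsRademacherSequence P ε) (hp : 2 < p)
    (hp' : p < 4) {C : ℝ} (hC0 : 0 ≤ C)
    (hC : ∀ n : ℕ, 0 < n → ∫ ω, |rademacherSum ε (fun _ => 1 / √n) n ω| ^ p ∂P ≤ C) :
    gaussMoment p ≤ C := by
  have hM := momentConst_pos hp hp'
  have key : ENNReal.ofReal (gaussMoment p * momentConst p) ≤
      ENNReal.ofReal (C * momentConst p) := by
    rw [← lintegral_gaussian_remainder hp hp']
    let F : ℕ → ℝ → ENNReal := fun n t =>
      ENNReal.ofReal ((cos (1 / √n * t) ^ n - 1 + t ^ 2 / 2) * t ^ (-p - 1))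
    -- Fatou's lemma suffices, since only a lower bound on the limiting moments is needed.
    calc _ = ∫⁻ t in Ioi 0, liminf (fun n => F n t) atTop := by
          refine lintegral_congr fun t => ?_
          refine (Tendsto.liminf_eq ?_).symm
          exact ENNReal.tendsto_ofReal ((((tendsto_cos_div_sqrt_pow t).sub_const 1).add_const
            (t ^ 2 / 2)).mul_const _)
      _ ≤ liminf (fun n => ∫⁻ t in Ioi 0, F n t) atTop := by
          refine lintegral_liminf_le fun n => Measurable.ennreal_ofReal (Measurable.mul ?_ ?_)
          · fun_prop
          · exact measurable_id.pow_const _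
      _ ≤ _ := by
          refine liminf_le_of_frequently_le' (Eventually.frequently ?_)
          filter_upwards [eventually_gt_atTop 0] with n hn
          have hn' : (0 : ℝ) < n := by exact_mod_cast hn
          have hb : ∑ k ∈ Finset.range n, (fun _ => 1 / √n : ℕ → ℝ) k ^ 2 = 1 := by
            simp only [Finset.sum_const, Finset.card_range, nsmul_eq_mul]
            rw [div_pow, sq_sqrt hn'.le]
            field_simp
          have e := h.lintegral_remainder hp hp' hb
          simp only [Finset.prod_const, Finset.card_range] at e
          rw [e]
          exact ENNReal.ofReal_le_ofReal (mul_le_mul_of_nonneg_right (hC n hn) hM.le)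
  rw [ENNReal.ofReal_le_ofReal_iff (by positivity)] at key
  exact le_of_mul_le_mul_right key hM

theorem IsRademacherSequence.isUpperKhintchineConstant (h : IsRademacherSequence P ε) (hp : 2 < p)
    (hp' : p < 4) : IsUpperKhintchineConstant P ε p (gaussMoment p ^ (1 / p)) := by
  have hp0 : 0 < p := by linarith
  have hg := gaussMoment_pos hp0
  refine ⟨by positivity, fun n a => ?_⟩
  rcases eq_or_ne a 0 with rfl | ha
  · simp [zero_rpow hp0.ne', zero_rpow (inv_pos.2 hp0).ne']
  have hσ : 0 < ‖a‖ := norm_pos_iff.2 ha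
  have hb : ∑ k ∈ Finset.range n, (if h : k < n then a ⟨k, h⟩ / ‖a‖ else 0) ^ 2 = 1 := by
    rw [Finset.sum_range]
    simp only [Fin.is_lt, dite_true, div_pow]
    rw [← Finset.sum_div, ← EuclideanSpace.real_norm_sq_eq, div_self (by positivity)]
  have hle := h.integral_le hp hp' hb
  have e : ∀ ω, |∑ k : Fin n, a k * ε k ω| ^ p =
      ‖a‖ ^ p * |rademacherSum ε (fun k => if h : k < n then a ⟨k, h⟩ / ‖a‖ else 0) n ω| ^ p := by
    intro ω
    rw [← sum_fin_eq_rademacherSum (fun k => a k / ‖a‖), ← mul_rpow hσ.le (abs_nonneg _)]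
    have e' : ∑ k : Fin n, a k * ε k ω = ‖a‖ * ∑ k : Fin n, a k / ‖a‖ * ε k ω := by
      rw [Finset.mul_sum]
      refine Finset.sum_congr rfl fun k _ => ?_
      field_simp
    rw [e', abs_mul, abs_of_pos hσ]
  simp only [e]
  rw [integral_const_mul, mul_rpow (by positivity) (integral_nonneg fun ω => by positivity),
    ← rpow_mul hσ.le, mul_one_div_cancel hp0.ne', rpow_one, mul_comm]
  refine mul_le_mul_of_nonneg_right ?_ hσ.le
  exact rpow_le_rpow (integral_nonneg fun ω => by positivity) hle (by positivity)

theorem IsRademacherSequence.isLeast_khintchine (h : IsRademacherSequence P ε) (hp : 2 < p)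
    (hp' : p < 4) :
    IsLeast {B : ℝ | IsUpperKhintchineConstant P ε p B} (gaussMoment p ^ (1 / p)) := by
  have hp0 : 0 < p := by linarith
  refine ⟨h.isUpperKhintchineConstant hp hp', fun B hB => ?_⟩
  obtain ⟨hB0, hB⟩ := hB
  have hC := h.gaussMoment_le hp hp' (C := B ^ p) (by positivity) fun n hn => ?_
  · calc gaussMoment p ^ (1 / p) ≤ (B ^ p) ^ (1 / p) :=
          rpow_le_rpow (gaussMoment_pos hp0).le hC (by positivity)
      _ = B := by rw [← rpow_mul hB0.le, mul_one_div_cancel hp0.ne', rpow_one]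
  · have hn' : (0 : ℝ) < n := by exact_mod_cast hn
    have hBn := hB n (WithLp.toLp 2 fun _ => 1 / √n)
    have hnorm : ‖(WithLp.toLp 2 fun _ => 1 / √n : EuclideanSpace ℝ (Fin n))‖ = 1 := by
      rw [EuclideanSpace.norm_eq]
      simp only [norm_eq_abs, sq_abs, Finset.sum_const, Finset.card_univ, Fintype.card_fin,
        nsmul_eq_mul, div_pow, one_pow, sq_sqrt hn'.le]
      rw [mul_one_div_cancel hn'.ne', sqrt_one]
    rw [hnorm, mul_one] at hBn
    have e : ∀ ω, ∑ k : Fin n, (WithLp.toLp 2 fun _ => 1 / √n : EuclideanSpace ℝ (Fin n)) k * ε k ω =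
        rademacherSum ε (fun _ => 1 / √n) n ω := by
      intro ω
      rw [rademacherSum, Finset.sum_range]
    simp only [e] at hBn
    have hI : 0 ≤ ∫ ω, |rademacherSum ε (fun _ => 1 / √n) n ω| ^ p ∂P :=
      integral_nonneg fun ω => by positivity
    calc _ = ((∫ ω, |rademacherSum ε (fun _ => 1 / √n) n ω| ^ p ∂P) ^ (1 / p)) ^ p := by
          rw [← rpow_mul hI, one_div_mul_cancel hp0.ne', rpow_one]
      _ ≤ B ^ p := rpow_le_rpow (by positivity) hBn hp0.le

end Khintchine

theorem theorem1p1 (p : ℝ) (hp2 : 2 < p) (hp3 : p < 3) :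
    (∀ {Ω : Type*} [MeasurableSpace Ω] (P : Measure Ω) [IsProbabilityMeasure P]
      (ε : ℕ → Ω → ℝ), IsRademacherSequence P ε →
      IsLeast {B : ℝ | IsUpperKhintchineConstant P ε p B}
        (√2 * (Real.Gamma ((p + 1) / 2) / √Real.pi) ^ (1 / p))) ∧
    (∀ s : ℝ, √2 ≤ s →
      IntegrableOn
        (fun t : ℝ => (Real.exp (-s * t ^ 2 / 2) - |Real.cos t| ^ s) * t ^ (-p - 1))
        (Set.Ioi 0) ∧
      0 ≤ ∫ t in Set.Ioi (0 : ℝ),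
        (Real.exp (-s * t ^ 2 / 2) - |Real.cos t| ^ s) * t ^ (-p - 1)) := by
  refine ⟨fun {Ω} _ P _ ε h => ?_, fun s hs => ⟨?_, ?_⟩⟩
  · rw [← gaussMoment_rpow (by linarith)]
    exact h.isLeast_khintchine hp2 (by linarith)
  · have hs1 : 1 ≤ s := le_trans (Real.le_sqrt_of_sq_le (by norm_num)) hs
    exact integrableOn_gaussCosDiff_mul_rpow hs1 (by linarith) (by linarith)
  · exact integral_gaussCosDiff_nonneg hs hp2.le (by linarith)
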